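/- Let $\mu=(\mu_1,\dots,\mu_k)$ be a vector of Borel probability measures on $\mathbb R^d$, let $\operatorname{supp}\mu=\bigcap_j\operatorname{supp}\mu_j$ (the common support when the $\mu_j$ share one), and for $q\in\mathbb R^k$ write $\mu(B(x,r))^q=\prod_j\mu_j(B(x,r))^{q_j}$, where $B(x,r)$ is the closed ball. **Dimensions.** A centred $\varepsilon$-covering (resp. $\varepsilon$-packing) of $E$ is a countable family of balls $B(x_i,r_i)$ with $x_i\in E$, $0<r_i<\varepsilon$, that covers $E$ (resp. is pairwise disjoint). For $q\in\mathbb R^k$, $t\in\mathbb R$ and $E\subseteq\mathbb R^d$ put $$\overline{\mathcal H}^{q,t}_\mu(E)=\sup_{\varepsilon>0}\ \inf\Big\{\sum_i\mu(B(x_i,r_i))^q(2r_i)^t\Big\},\qquad \mathcal H^{q,t}_\mu(E)=\sup_{F\subseteq E}\overline{\mathcal H}^{q,t}_\mu(F),$$ the infimum over all centred $\varepsilon$-coverings of $E$, and $$\overline{\mathcal P}^{q,t}_\mu(E)=\inf_{\varepsilon>0}\ \sup\Big\{\sum_i\mu(B(x_i,r_i))^q(2r_i)^t\Big\},\qquad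 \mathcal P^{q,t}_\mu(E)=\inf_{E\subseteq\bigcup_iE_i}\sum_i\overline{\mathcal P}^{q,t}_\mu(E_i),$$ the supremum over all centred $\varepsilon$-packings of $E$ and the last infimum over countable covers $(E_i)$ of $E$. Let $b_\mu(q)$, $B_\mu(q)$, $\Lambda_\mu(q)\in[-\infty,+\infty]$ be the infima of those $t\in\mathbb R$ for which, respectively, $\mathcal H^{q,t}_\mu(\operatorname{supp}\mu)=0$, $\mathcal P^{q,t}_\mu(\operatorname{supp}\mu)=0$, $\overline{\mathcal P}^{q,t}_\mu(\operatorname{supp}\mu)=0$. For $f:\mathbb R^k\to[-\infty,+\infty]$ let $f^*(\alpha)=\inf_{q\in\mathbb R^k}\big(\langle\alpha,q\rangle+f(q)\big)$. **Level sets.** For $\alpha\in\mathbb R^k$ let $$\underline X_\alpha=\Big\{x\in\operatorname{supp}\mu:\ \liminf_{r\downarrow0}\tfrac{\log\mu_j(B(x,r))}{\log r}\ge\alpha_j\ \ \forall j\Big\},\qquad \overline X^{\alpha}=\Big\{x\in\operatorname{supp}\mu:\ \limsup_{r\downarrow0}\tfrac{\log\mu_j(B(x,r))}{\log r}\le\alpha_j\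 \ \forall j\Big\},$$ and $f_\mu(\alpha)=\dim(\underline X_\alpha\cap\overline X^\alpha)$, where $\dim$ is the Hausdorff dimension. **Theorem.** Fix $q\in\mathbb R^k$. Let $t_q\in\mathbb R$, $r_q,\underline K_q,\overline K_q>0$, let $\nu_q$ be a Borel probability measure supported by $\operatorname{supp}\mu$, let $\varphi_q$ be a real function with $\varphi_q(r)=o(\log r)$ as $r\downarrow0$, and let $(r_{q,n})_n\subset(0,1)$ be a non-increasing sequence with $r_{q,n}\to0$, $\log r_{q,n+1}/\log r_{q,n}\to1$ and $\sum_nr_{q,n}^{\varepsilon}<\infty$ for every $\varepsilon>0$. Assume: * (A1) for all $x\in\operatorname{supp}\mu$ and $r\in(0,r_q)$, $$\underline K_q\le\frac{\nu_q(B(x,r))}{\mu(B(x,r))^q\,(2r)^{t_q}\,e^{\varphi_q(r)}}\le\overline K_q;$$ * (A2) for all $p\in\mathbb R^k$ the limit $$C_q(p)=\lim_{n\to\infty}\frac1{-\log r_{q,n}}\log\int_{\operatorname{supp}\mu}\mu(B(x,r_{q,n}))^p\,d\nu_q(x)$$ exists and is finite. Then the right and left partial derivatives of $C_q$ at $0$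 exist; let $\nabla_+C_q(0)$ and $\nabla_-C_q(0)$ be the vectors they form. Moreover: (i) If $q_j\le0$ for all $j$, then $$\dim\big(\underline X_{-\nabla_+C_q(0)}\cap\overline X^{-\nabla_-C_q(0)}\big)\ge\langle-\nabla_-C_q(0),q\rangle+\Lambda_\mu(q)\ge\langle-\nabla_-C_q(0),q\rangle+B_\mu(q)\ge\langle-\nabla_-C_q(0),q\rangle+b_\mu(q).$$ If $q_j\ge0$ for all $j$, then $$\dim\big(\underline X_{-\nabla_+C_q(0)}\cap\overline X^{-\nabla_-C_q(0)}\big)\ge\langle-\nabla_+C_q(0),q\rangle+\Lambda_\mu(q)\ge\langle-\nabla_+C_q(0),q\rangle+B_\mu(q)\ge\langle-\nabla_+C_q(0),q\rangle+b_\mu(q).$$ (ii) If $C_q$ is differentiable at $0$, then (for this $q$, of arbitrary signs) $$f_\mu(-\nabla C_q(0))=b_\mu^*(-\nabla C_q(0))=B_\mu^*(-\nabla C_q(0))=\Lambda_\mu^*(-\nabla C_q(0)).$$ -/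

import Mathlib

open MeasureTheory Filter Set
open scoped Topology ENNReal NNReal BigOperators

noncomputable section

namespace MixedMultifractal

/-- The support of the vector-valued measure `μ = (μ_1, …, μ_k)`: the points all of whose
neighbourhoods are charged by every `μ_j`. It is the common support when the `μ_j` share one. -/
def vsupport {d k : ℕ} (μ : Fin k → Measure (EuclideanSpace ℝ (Fin d))) :
    Set (EuclideanSpace ℝ (Fin d)) :=
  ⋂ j, (μ j).support

/-- `(μ(B(x,r)))^q = ∏_j μ_j(B(x,r))^{q_j}`, with closed balls. -/
def ballPow {d k : ℕ} (μ : Fin k → Measure (EuclideanSpace ℝ (Fin d)))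
    (q : EuclideanSpace ℝ (Fin k)) (x : EuclideanSpace ℝ (Fin d)) (r : ℝ) : ℝ≥0∞ :=
  ∏ j, (μ j (Metric.closedBall x r)) ^ (q j)

/-- The sum `∑_i (μ(B(x_i,r_i)))^q (2 r_i)^t` over a family of (centre, radius) pairs. -/
def ballSum {d k : ℕ} (μ : Fin k → Measure (EuclideanSpace ℝ (Fin d)))
    (q : EuclideanSpace ℝ (Fin k)) (t : ℝ)
    (C : Set (EuclideanSpace ℝ (Fin d) × ℝ)) : ℝ≥0∞ :=
  ∑' p : C, ballPow μ q p.1.1 p.1.2 * ENNReal.ofReal ((2 * p.1.2) ^ t)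

/-- A centred `ε`-covering of `E`: a countable family of balls `B(x_i,r_i)` with `x_i ∈ E` and
`0 < r_i < ε` that covers `E`. -/
def IsCenteredCovering {d : ℕ} (ε : ℝ) (E : Set (EuclideanSpace ℝ (Fin d)))
    (C : Set (EuclideanSpace ℝ (Fin d) × ℝ)) : Prop :=
  C.Countable ∧ (∀ p ∈ C, p.1 ∈ E ∧ 0 < p.2 ∧ p.2 < ε) ∧
    E ⊆ ⋃ p ∈ C, Metric.closedBall p.1 p.2

/-- A centred `ε`-packing of `E`: a countable family of pairwise disjoint balls `B(x_i,r_i)` with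
`x_i ∈ E` and `0 < r_i < ε`. -/
def IsCenteredPacking {d : ℕ} (ε : ℝ) (E : Set (EuclideanSpace ℝ (Fin d)))
    (C : Set (EuclideanSpace ℝ (Fin d) × ℝ)) : Prop :=
  C.Countable ∧ (∀ p ∈ C, p.1 ∈ E ∧ 0 < p.2 ∧ p.2 < ε) ∧
    C.PairwiseDisjoint (fun p => Metric.closedBall p.1 p.2)

/-- The pre-measure `H̄_μ^{q,t}(E) = lim_{ε ↓ 0} H̄_{μ,ε}^{q,t}(E) = sup_{ε > 0} H̄_{μ,ε}^{q,t}(E)`,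
where `H̄_{μ,ε}^{q,t}(E)` is the infimum of `ballSum` over the centred `ε`-coverings of `E`. -/
def preHausdorff {d k : ℕ} (μ : Fin k → Measure (EuclideanSpace ℝ (Fin d)))
    (q : EuclideanSpace ℝ (Fin k)) (t : ℝ) (E : Set (EuclideanSpace ℝ (Fin d))) : ℝ≥0∞ :=
  ⨆ (ε : ℝ) (_ : 0 < ε), ⨅ (C : Set (EuclideanSpace ℝ (Fin d) × ℝ))
    (_ : IsCenteredCovering ε E C), ballSum μ q t C

/-- The mixed multifractal Hausdorff measure `H_μ^{q,t}(E) = sup_{F ⊆ E} H̄_μ^{q,t}(F)`. -/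
def mixedHausdorff {d k : ℕ} (μ : Fin k → Measure (EuclideanSpace ℝ (Fin d)))
    (q : EuclideanSpace ℝ (Fin k)) (t : ℝ) (E : Set (EuclideanSpace ℝ (Fin d))) : ℝ≥0∞ :=
  ⨆ (F : Set (EuclideanSpace ℝ (Fin d))) (_ : F ⊆ E), preHausdorff μ q t F

/-- The pre-measure `P̄_μ^{q,t}(E) = lim_{ε ↓ 0} P̄_{μ,ε}^{q,t}(E) = inf_{ε > 0} P̄_{μ,ε}^{q,t}(E)`,
where `P̄_{μ,ε}^{q,t}(E)` is the supremum of `ballSum` over the centred `ε`-packings of `E`. -/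
def prePacking {d k : ℕ} (μ : Fin k → Measure (EuclideanSpace ℝ (Fin d)))
    (q : EuclideanSpace ℝ (Fin k)) (t : ℝ) (E : Set (EuclideanSpace ℝ (Fin d))) : ℝ≥0∞ :=
  ⨅ (ε : ℝ) (_ : 0 < ε), ⨆ (C : Set (EuclideanSpace ℝ (Fin d) × ℝ))
    (_ : IsCenteredPacking ε E C), ballSum μ q t C

/-- The mixed multifractal packing measure
`P_μ^{q,t}(E) = inf { ∑_i P̄_μ^{q,t}(E_i) : E ⊆ ⋃_i E_i }`. -/
def mixedPacking {d k : ℕ} (μ : Fin k → Measure (EuclideanSpace ℝ (Fin d)))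
    (q : EuclideanSpace ℝ (Fin k)) (t : ℝ) (E : Set (EuclideanSpace ℝ (Fin d))) : ℝ≥0∞ :=
  ⨅ (A : ℕ → Set (EuclideanSpace ℝ (Fin d))) (_ : E ⊆ ⋃ i, A i), ∑' i, prePacking μ q t (A i)

/-- `b_μ(q)`: the mixed multifractal Hausdorff dimension of the support of `μ`, the critical
exponent of `t ↦ H_μ^{q,t}`. -/
def bDim {d k : ℕ} (μ : Fin k → Measure (EuclideanSpace ℝ (Fin d)))
    (q : EuclideanSpace ℝ (Fin k)) : EReal :=
  sInf ((fun t : ℝ => (t : EReal)) '' {t : ℝ | mixedHausdorff μ q t (vsupport μ) = 0})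

/-- `B_μ(q)`: the mixed multifractal packing dimension of the support of `μ`, the critical
exponent of `t ↦ P_μ^{q,t}`. -/
def BDim {d k : ℕ} (μ : Fin k → Measure (EuclideanSpace ℝ (Fin d)))
    (q : EuclideanSpace ℝ (Fin k)) : EReal :=
  sInf ((fun t : ℝ => (t : EReal)) '' {t : ℝ | mixedPacking μ q t (vsupport μ) = 0})

/-- `Λ_μ(q)`: the mixed multifractal logarithmic index of the support of `μ`, the critical
exponent of `t ↦ P̄_μ^{q,t}`. -/
def LambdaDim {d k : ℕ} (μ : Fin k → Measure (EuclideanSpace ℝ (Fin d)))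
    (q : EuclideanSpace ℝ (Fin k)) : EReal :=
  sInf ((fun t : ℝ => (t : EReal)) '' {t : ℝ | prePacking μ q t (vsupport μ) = 0})

/-- The lower local dimension `liminf_{r ↓ 0} log m(B(x,r)) / log r` in `[-∞, ∞]`. -/
def lowerLocalDim {d : ℕ} (m : Measure (EuclideanSpace ℝ (Fin d)))
    (x : EuclideanSpace ℝ (Fin d)) : EReal :=
  liminf (fun r : ℝ => ((Real.log (m.real (Metric.closedBall x r)) / Real.log r : ℝ) : EReal))
    (𝓝[>] (0 : ℝ))

/-- The upper local dimension `limsup_{r ↓ 0} log m(B(x,r)) / log r` in `[-∞, ∞]`. -/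
def upperLocalDim {d : ℕ} (m : Measure (EuclideanSpace ℝ (Fin d)))
    (x : EuclideanSpace ℝ (Fin d)) : EReal :=
  limsup (fun r : ℝ => ((Real.log (m.real (Metric.closedBall x r)) / Real.log r : ℝ) : EReal))
    (𝓝[>] (0 : ℝ))

/-- `X̲_α`: the points of the support at which every lower local dimension is at least `α_j`. -/
def lowerLevel {d k : ℕ} (μ : Fin k → Measure (EuclideanSpace ℝ (Fin d)))
    (α : EuclideanSpace ℝ (Fin k)) : Set (EuclideanSpace ℝ (Fin d)) :=
  {x ∈ vsupport μ | ∀ j, ((α j : ℝ) : EReal) ≤ lowerLocalDim (μ j) x}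

/-- `X̄^α`: the points of the support at which every upper local dimension is at most `α_j`. -/
def upperLevel {d k : ℕ} (μ : Fin k → Measure (EuclideanSpace ℝ (Fin d)))
    (α : EuclideanSpace ℝ (Fin k)) : Set (EuclideanSpace ℝ (Fin d)) :=
  {x ∈ vsupport μ | ∀ j, upperLocalDim (μ j) x ≤ ((α j : ℝ) : EReal)}

/-- The mixed multifractal spectrum `f_μ(α) = dim (X̲_α ∩ X̄^α)`, `dim` the Hausdorff dimension. -/
def mixedSpectrum {d k : ℕ} (μ : Fin k → Measure (EuclideanSpace ℝ (Fin d)))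
    (α : EuclideanSpace ℝ (Fin k)) : EReal :=
  ((dimH (lowerLevel μ α ∩ upperLevel μ α) : ℝ≥0∞) : EReal)

/-- The Legendre transform `f^*(α) = inf_q (⟨α, q⟩ + f(q))`. -/
def legendre {k : ℕ} (f : EuclideanSpace ℝ (Fin k) → EReal)
    (α : EuclideanSpace ℝ (Fin k)) : EReal :=
  ⨅ q : EuclideanSpace ℝ (Fin k), ((inner ℝ α q : ℝ) : EReal) + f q

/-- `C_n(p) = (1 / (-log ρ)) log ∫_{supp μ} (μ(B(x,ρ)))^p dν(x)` at the scale `ρ ∈ (0,1)`. -/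
def momentExponent {d k : ℕ} (μ : Fin k → Measure (EuclideanSpace ℝ (Fin d)))
    (ν : Measure (EuclideanSpace ℝ (Fin d))) (ρ : ℝ) (p : EuclideanSpace ℝ (Fin k)) : EReal :=
  ((1 / (-Real.log ρ) : ℝ) : EReal) *
    ENNReal.log (∫⁻ x in vsupport μ, ballPow μ p x ρ ∂ν)

/-- The restriction of `C : ℝ^k → ℝ` to the `j`-th coordinate axis. -/
def axisRestrict {k : ℕ} (C : EuclideanSpace ℝ (Fin k) → ℝ) (j : Fin k) (s : ℝ) : ℝ :=
  C (EuclideanSpace.single j s)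

/-- `∇_+ C(0)`: the vector of the right partial derivatives of `C` at `0`. -/
def rightGrad {k : ℕ} (C : EuclideanSpace ℝ (Fin k) → ℝ) : EuclideanSpace ℝ (Fin k) :=
  WithLp.toLp 2 (fun j => derivWithin (axisRestrict C j) (Set.Ioi 0) 0)

/-- `∇_- C(0)`: the vector of the left partial derivatives of `C` at `0`. -/
def leftGrad {k : ℕ} (C : EuclideanSpace ℝ (Fin k) → ℝ) : EuclideanSpace ℝ (Fin k) :=
  WithLp.toLp 2 (fun j => derivWithin (axisRestrict C j) (Set.Iio 0) 0)

end MixedMultifractal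

end

/-!
The moment exponent `C` is convex by Hölder's inequality (`convexOn_of_tendsto_momentExponent`), so
its one-sided partial derivatives at `0` exist, and `C 0 = 0`. Since `∫ μ(B(x,ρ_n))^p dν` is about
`ρ_n ^ (-C p)`, Markov's inequality and the Borel–Cantelli lemma bound `μ(B(x,ρ_n))^p` at `ν`-almost
every `x`. Taking `p = s e_j` with small `s` of either sign, and filling in the radii between
consecutive `ρ_n`, places the local dimensions of `μ j` between `-∂_j^+ C(0)` and `-∂_j^- C(0)`.
Hence `X̲_{-∇₊C(0)} ∩ X̄^{-∇₋C(0)}` has full `ν`-measure (`ae_mem_level_inter`).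

The comparison of `ν` with `μ^q (2r)^t e^{φ(r)}` is used twice. Its upper half bounds the local
dimension of `ν` on that set from below, and the mass distribution principle turns this into a lower
bound for the Hausdorff dimension (`add_le_dimH_of_gibbs`). Its lower half dominates packing sums by
`ν`-masses of disjoint balls, so `Λ_μ(q) ≤ t` (`LambdaDim_le_of_gibbs`). The inequalities
`b_μ ≤ B_μ ≤ Λ_μ` hold for all `μ`; the first one rests on Besicovitch's covering theorem.

If `C` is differentiable at `0`, both gradients agree, and every local dimension on
`X̲_α ∩ X̄^α`, `α = -∇C(0)`, is a limit; the sign of `q` then plays no role. A covering argument gives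
`dim (X̲_α ∩ X̄^α) ≤ ⟨α, p⟩ + b_μ(p)` for every `p` (`mixedSpectrum_le_legendre_bDim`), where it
matters that the set is nonempty, having positive `ν`-measure. This closes the chain
`f_μ(α) ≤ b_μ^*(α) ≤ B_μ^*(α) ≤ Λ_μ^*(α) ≤ ⟨α, q⟩ + Λ_μ(q) ≤ f_μ(α)`.
-/

namespace MixedMultifractal

/-! ### Comparison of the mixed Hausdorff and packing measures -/

section Comparison

variable {d k : ℕ} (μ : Fin k → Measure (EuclideanSpace ℝ (Fin d)))
  (q : EuclideanSpace ℝ (Fin k)) (t : ℝ)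

theorem ballSum_iUnion_le {ι : Type*} (D : ι → Set (EuclideanSpace ℝ (Fin d) × ℝ)) :
    ballSum μ q t (⋃ i, D i) ≤ ∑' i, ballSum μ q t (D i) := by
  unfold ballSum
  exact ENNReal.tsum_iUnion_le_tsum
    (fun p : EuclideanSpace ℝ (Fin d) × ℝ =>
      ballPow μ q p.1 p.2 * ENNReal.ofReal ((2 * p.2) ^ t)) D

theorem prePacking_empty : prePacking μ q t ∅ = 0 := by
  refine le_antisymm (iInf₂_le_of_le 1 one_pos (iSup₂_le fun C hC => ?_)) zero_le
  have : C = ∅ := eq_empty_of_forall_notMem fun p hp => (hC.2.1 p hp).1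
  subst this
  simp [ballSum]

theorem prePacking_mono {E F : Set (EuclideanSpace ℝ (Fin d))} (h : E ⊆ F) :
    prePacking μ q t E ≤ prePacking μ q t F :=
  iInf₂_mono fun _ _ => iSup₂_le fun C hC =>
    le_iSup₂_of_le C ⟨hC.1, fun p hp => ⟨h (hC.2.1 p hp).1, (hC.2.1 p hp).2⟩, hC.2.2⟩ le_rfl

theorem mixedPacking_le_prePacking (E : Set (EuclideanSpace ℝ (Fin d))) :
    mixedPacking μ q t E ≤ prePacking μ q t E := by
  refine iInf₂_le_of_le (fun i => if i = 0 then E else ∅)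
    (subset_iUnion_of_subset 0 (by simp)) ?_
  rw [tsum_eq_single 0]
  · simp
  · intro i hi
    simp [hi, prePacking_empty]

/-- Besicovitch's covering theorem, applied to balls of one small radius centred at the points
of `E`, splits a centred covering of `E` into boundedly many centred packings of `E`. -/
theorem exists_preHausdorff_le_mul_prePacking (d : ℕ) :
    ∃ N : ℕ, ∀ {k : ℕ} (μ : Fin k → Measure (EuclideanSpace ℝ (Fin d)))
      (q : EuclideanSpace ℝ (Fin k)) (t : ℝ) (E : Set (EuclideanSpace ℝ (Fin d))),
      preHausdorff μ q t E ≤ (N + 1 : ℝ≥0∞) * prePacking μ q t E := by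
  obtain ⟨N, τ, hτ, hN⟩ :=
    HasBesicovitchCovering.no_satelliteConfig (α := EuclideanSpace ℝ (Fin d))
  refine ⟨N, fun {k} μ q t E => ?_⟩
  refine iSup₂_le fun ε hε => ?_
  have hne : (N + 1 : ℝ≥0∞) ≠ 0 := by simp
  have htop : (N + 1 : ℝ≥0∞) ≠ ∞ := by finiteness
  simp only [prePacking, ENNReal.mul_iInf_of_ne hne htop]
  refine le_iInf₂ fun ε' hε' => ?_
  set r : ℝ := min ε ε' / 2 with hr
  have hr0 : 0 < r := by positivity
  have hrε : r < ε := by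
    have := min_le_left ε ε'
    linarith [lt_min hε hε']
  have hrε' : r < ε' := by
    have := min_le_right ε ε'
    linarith [lt_min hε hε']
  obtain ⟨s, hsd, hsc⟩ := Besicovitch.exist_disjoint_covering_families hτ hN
    (⟨fun x : E => (x : EuclideanSpace ℝ (Fin d)), fun _ => r, fun _ => hr0, r, fun _ => le_rfl⟩ :
      Besicovitch.BallPackage E (EuclideanSpace ℝ (Fin d)))
  let D : Fin N → Set (EuclideanSpace ℝ (Fin d) × ℝ) := fun i => (fun x : E => (x.1, r)) '' s i
  have hD : ∀ i, IsCenteredPacking ε' E (D i) := by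
    intro i
    refine ⟨?_, ?_, ?_⟩
    · refine Countable.image ?_ _
      exact (hsd i).countable_of_nonempty_interior fun x _ =>
        ⟨x.1, Metric.ball_subset_interior_closedBall (Metric.mem_ball_self hr0)⟩
    · rintro _ ⟨x, _, rfl⟩
      exact ⟨x.2, hr0, hrε'⟩
    · rintro _ ⟨x, hx, rfl⟩ _ ⟨y, hy, rfl⟩ hxy
      exact hsd i hx hy fun h => hxy (by rw [h])
  have hcov : IsCenteredCovering ε E (⋃ i, D i) := by
    refine ⟨countable_iUnion fun i => (hD i).1, ?_, ?_⟩
    · intro p hp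
      obtain ⟨i, x, _, rfl⟩ := mem_iUnion.1 hp
      exact ⟨x.2, hr0, hrε⟩
    · intro x hx
      obtain ⟨i, hi⟩ := mem_iUnion.1 (hsc ⟨⟨x, hx⟩, rfl⟩)
      obtain ⟨y, hy, hxy⟩ := mem_iUnion₂.1 hi
      exact mem_iUnion₂.2
        ⟨(y.1, r), mem_iUnion.2 ⟨i, y, hy, rfl⟩, Metric.ball_subset_closedBall hxy⟩
  refine iInf₂_le_of_le _ hcov ?_
  calc ballSum μ q t (⋃ i, D i)
      ≤ ∑ i, ballSum μ q t (D i) :=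
        (ballSum_iUnion_le μ q t D).trans_eq (tsum_fintype _)
    _ ≤ ∑ _i : Fin N, ⨆ (C : Set (EuclideanSpace ℝ (Fin d) × ℝ))
          (_ : IsCenteredPacking ε' E C), ballSum μ q t C :=
        Finset.sum_le_sum fun i _ => le_iSup₂_of_le (D i) (hD i) le_rfl
    _ ≤ _ := by
        rw [Finset.sum_const, Finset.card_univ, Fintype.card_fin, nsmul_eq_mul]
        gcongr
        exact le_self_add

/-- Centred pre-measures are countably subadditive as soon as every piece lies inside the set
they cover, because then the centres stay admissible. -/
theorem preHausdorff_le_tsum {E : Set (EuclideanSpace ℝ (Fin d))}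
    (A : ℕ → Set (EuclideanSpace ℝ (Fin d))) (hA : E ⊆ ⋃ i, A i) :
    preHausdorff μ q t E ≤ ∑' i, preHausdorff μ q t (E ∩ A i) := by
  refine iSup₂_le fun ε hε => ?_
  refine ENNReal.le_of_forall_pos_le_add fun η hη hfin => ?_
  obtain ⟨δ, hδ, hδη⟩ := ENNReal.exists_pos_sum_of_countable (ENNReal.coe_pos.2 hη).ne' ℕ
  have h : ∀ i, ∃ D, IsCenteredCovering ε (E ∩ A i) D ∧
      ballSum μ q t D ≤ preHausdorff μ q t (E ∩ A i) + δ i := by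
    intro i
    have h1 : (⨅ (C : Set (EuclideanSpace ℝ (Fin d) × ℝ))
        (_ : IsCenteredCovering ε (E ∩ A i) C), ballSum μ q t C) <
        preHausdorff μ q t (E ∩ A i) + δ i :=
      (le_iSup₂_of_le (f := fun (ε : ℝ) (_ : 0 < ε) =>
          ⨅ (C : Set (EuclideanSpace ℝ (Fin d) × ℝ))
            (_ : IsCenteredCovering ε (E ∩ A i) C), ballSum μ q t C) ε hε le_rfl).trans_lt
        (ENNReal.lt_add_right (ENNReal.ne_top_of_tsum_ne_top hfin.ne i)
          (ENNReal.coe_pos.2 (hδ i)).ne')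
    obtain ⟨D, hD⟩ := iInf_lt_iff.1 h1
    obtain ⟨hD, hlt⟩ := iInf_lt_iff.1 hD
    exact ⟨D, hD, hlt.le⟩
  choose D hD hDle using h
  have hcov : IsCenteredCovering ε E (⋃ i, D i) := by
    refine ⟨countable_iUnion fun i => (hD i).1, ?_, ?_⟩
    · intro p hp
      obtain ⟨i, hi⟩ := mem_iUnion.1 hp
      exact ⟨((hD i).2.1 p hi).1.1, ((hD i).2.1 p hi).2⟩
    · intro x hx
      obtain ⟨i, hi⟩ := mem_iUnion.1 (hA hx)
      obtain ⟨p, hp, hxp⟩ := mem_iUnion₂.1 ((hD i).2.2 ⟨hx, hi⟩)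
      exact mem_iUnion₂.2 ⟨p, mem_iUnion.2 ⟨i, hp⟩, hxp⟩
  refine iInf₂_le_of_le _ hcov ?_
  calc ballSum μ q t (⋃ i, D i) ≤ ∑' i, ballSum μ q t (D i) := ballSum_iUnion_le μ q t D
    _ ≤ ∑' i, (preHausdorff μ q t (E ∩ A i) + δ i) := ENNReal.tsum_le_tsum hDle
    _ ≤ _ := by
        rw [ENNReal.tsum_add]
        gcongr

theorem exists_mixedHausdorff_le_mul_mixedPacking (d : ℕ) :
    ∃ N : ℕ, ∀ {k : ℕ} (μ : Fin k → Measure (EuclideanSpace ℝ (Fin d)))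
      (q : EuclideanSpace ℝ (Fin k)) (t : ℝ) (E : Set (EuclideanSpace ℝ (Fin d))),
      mixedHausdorff μ q t E ≤ (N + 1 : ℝ≥0∞) * mixedPacking μ q t E := by
  obtain ⟨N, hN⟩ := exists_preHausdorff_le_mul_prePacking d
  refine ⟨N, fun {k} μ q t E => iSup₂_le fun F hF => ?_⟩
  have hne : (N + 1 : ℝ≥0∞) ≠ 0 := by simp
  have htop : (N + 1 : ℝ≥0∞) ≠ ∞ := by finiteness
  simp only [mixedPacking, ENNReal.mul_iInf_of_ne hne htop]
  refine le_iInf₂ fun A hA => ?_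
  rw [← ENNReal.tsum_mul_left]
  refine (preHausdorff_le_tsum μ q t A (hF.trans hA)).trans (ENNReal.tsum_le_tsum fun i => ?_)
  refine (hN μ q t _).trans ?_
  gcongr
  exact prePacking_mono μ q t inter_subset_right

theorem bDim_le_BDim : bDim μ q ≤ BDim μ q := by
  obtain ⟨N, hN⟩ := exists_mixedHausdorff_le_mul_mixedPacking d
  refine sInf_le_sInf (image_mono fun t ht => ?_)
  have h := hN μ q t (vsupport μ)
  rw [mem_ofPred_eq] at ht
  rw [ht, mul_zero] at h
  exact le_antisymm h zero_le

theorem BDim_le_LambdaDim : BDim μ q ≤ LambdaDim μ q := by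
  refine sInf_le_sInf (image_mono fun t (ht : prePacking μ q t _ = 0) => ?_)
  exact le_antisymm ((mixedPacking_le_prePacking μ q t _).trans ht.le) zero_le

end Comparison

/-! ### Masses of balls centred in the support -/

section Balls

variable {d k : ℕ} {μ : Fin k → Measure (EuclideanSpace ℝ (Fin d))}

theorem measurableSet_vsupport : MeasurableSet (vsupport μ) :=
  MeasurableSet.iInter fun _ => Measure.isClosed_support.measurableSet

theorem measurable_measure_closedBall (m : Measure (EuclideanSpace ℝ (Fin d))) [SFinite m]
    (r : ℝ) : Measurable fun x => m (Metric.closedBall x r) := by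
  have h : MeasurableSet {p : EuclideanSpace ℝ (Fin d) × EuclideanSpace ℝ (Fin d) |
      dist p.2 p.1 ≤ r} :=
    (isClosed_le (by fun_prop) continuous_const).measurableSet
  exact measurable_measure_prodMk_left h

theorem measurable_ballPow [∀ j, IsProbabilityMeasure (μ j)] (p : EuclideanSpace ℝ (Fin k))
    (r : ℝ) : Measurable fun x => ballPow μ p x r :=
  Finset.measurable_prod _ fun j _ => (measurable_measure_closedBall (μ j) r).pow_const _

theorem measure_closedBall_pos_of_mem_vsupport {x : EuclideanSpace ℝ (Fin d)}
    (hx : x ∈ vsupport μ) {r : ℝ} (hr : 0 < r) (j : Fin k) :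
    0 < μ j (Metric.closedBall x r) :=
  (Measure.mem_support_iff_forall x).1 (mem_iInter.1 hx j) _ (Metric.closedBall_mem_nhds x hr)

theorem measureReal_closedBall_pos [∀ j, IsProbabilityMeasure (μ j)]
    {x : EuclideanSpace ℝ (Fin d)} (hx : x ∈ vsupport μ) {r : ℝ} (hr : 0 < r) (j : Fin k) :
    0 < (μ j).real (Metric.closedBall x r) :=
  ENNReal.toReal_pos (measure_closedBall_pos_of_mem_vsupport hx hr j).ne' (measure_ne_top _ _)

theorem prod_rpow_eq_exp [∀ j, IsProbabilityMeasure (μ j)] {x : EuclideanSpace ℝ (Fin d)}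
    (hx : x ∈ vsupport μ) {r : ℝ} (hr : 0 < r) (p : EuclideanSpace ℝ (Fin k)) :
    ∏ j, ((μ j).real (Metric.closedBall x r)) ^ (p j) =
      Real.exp (∑ j, p j * Real.log ((μ j).real (Metric.closedBall x r))) := by
  rw [Real.exp_sum]
  refine Finset.prod_congr rfl fun j _ => ?_
  rw [Real.rpow_def_of_pos (measureReal_closedBall_pos hx hr j), mul_comm]

theorem ballPow_eq_ofReal_prod [∀ j, IsProbabilityMeasure (μ j)] {x : EuclideanSpace ℝ (Fin d)}
    (hx : x ∈ vsupport μ) {r : ℝ} (hr : 0 < r) (p : EuclideanSpace ℝ (Fin k)) :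
    ballPow μ p x r =
      ENNReal.ofReal (∏ j, ((μ j).real (Metric.closedBall x r)) ^ (p j)) := by
  rw [ENNReal.ofReal_prod_of_nonneg fun j _ => by positivity]
  refine Finset.prod_congr rfl fun j _ => ?_
  rw [← ENNReal.ofReal_rpow_of_pos (measureReal_closedBall_pos hx hr j), ofReal_measureReal]

theorem ballPow_eq_ofReal_exp [∀ j, IsProbabilityMeasure (μ j)] {x : EuclideanSpace ℝ (Fin d)}
    (hx : x ∈ vsupport μ) {r : ℝ} (hr : 0 < r) (p : EuclideanSpace ℝ (Fin k)) :
    ballPow μ p x r = ENNReal.ofReal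
      (Real.exp (∑ j, p j * Real.log ((μ j).real (Metric.closedBall x r)))) := by
  rw [ballPow_eq_ofReal_prod hx hr, prod_rpow_eq_exp hx hr]

theorem ballPow_convex_combination [∀ j, IsProbabilityMeasure (μ j)]
    {x : EuclideanSpace ℝ (Fin d)} (hx : x ∈ vsupport μ) {r : ℝ} (hr : 0 < r)
    (p p' : EuclideanSpace ℝ (Fin k)) {a b : ℝ} (ha : 0 ≤ a) (hb : 0 ≤ b) :
    ballPow μ (a • p + b • p') x r = ballPow μ p x r ^ a * ballPow μ p' x r ^ b := by
  simp only [ballPow, ← ENNReal.prod_rpow_of_nonneg ha, ← ENNReal.prod_rpow_of_nonneg hb,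
    ← Finset.prod_mul_distrib]
  refine Finset.prod_congr rfl fun j _ => ?_
  rw [← ENNReal.rpow_mul, ← ENNReal.rpow_mul, ← ENNReal.rpow_add _ _
    (measure_closedBall_pos_of_mem_vsupport hx hr j).ne' (measure_ne_top _ _)]
  simp [mul_comm]

end Balls

/-! ### The moment exponent -/

section Moments

variable {d k : ℕ} {μ : Fin k → Measure (EuclideanSpace ℝ (Fin d))}
  {ν : Measure (EuclideanSpace ℝ (Fin d))}

theorem momentExponent_le_iff {r : ℝ} (hr : r ∈ Ioo (0 : ℝ) 1) (p : EuclideanSpace ℝ (Fin k))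
    (c : ℝ) : momentExponent μ ν r p ≤ (c : EReal) ↔
      ∫⁻ x in vsupport μ, ballPow μ p x r ∂ν ≤ ENNReal.ofReal (r ^ (-c)) := by
  have hlog : 0 < -Real.log r := neg_pos.2 (Real.log_neg hr.1 hr.2)
  rw [← ENNReal.log_le_log_iff, ENNReal.log_ofReal_of_pos (Real.rpow_pos_of_pos hr.1 _),
    Real.log_rpow hr.1, momentExponent, mul_comm, one_div, EReal.coe_inv, ← div_eq_mul_inv,
    EReal.div_le_iff_le_mul (by exact_mod_cast hlog) (EReal.coe_ne_top _), ← EReal.coe_mul]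
  ring_nf

/-- Hölder's inequality for the moments `∫ μ(B(x,r))^p dν`, in exponential form. -/
theorem momentExponent_convex_combination_le [∀ j, IsProbabilityMeasure (μ j)] {r : ℝ}
    (hr : r ∈ Ioo (0 : ℝ) 1) {p p' : EuclideanSpace ℝ (Fin k)} {a b c c' : ℝ} (ha : 0 ≤ a)
    (hb : 0 ≤ b) (hab : a + b = 1) (hc : momentExponent μ ν r p ≤ (c : EReal))
    (hc' : momentExponent μ ν r p' ≤ (c' : EReal)) :
    momentExponent μ ν r (a • p + b • p') ≤ ((a * c + b * c' : ℝ) : EReal) := by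
  rw [momentExponent_le_iff hr] at hc hc' ⊢
  calc ∫⁻ x in vsupport μ, ballPow μ (a • p + b • p') x r ∂ν
      = ∫⁻ x in vsupport μ, ballPow μ p x r ^ a * ballPow μ p' x r ^ b ∂ν :=
        setLIntegral_congr_fun measurableSet_vsupport fun x hx =>
          ballPow_convex_combination hx hr.1 p p' ha hb
    _ ≤ (∫⁻ x in vsupport μ, ballPow μ p x r ∂ν) ^ a *
          (∫⁻ x in vsupport μ, ballPow μ p' x r ∂ν) ^ b :=
        ENNReal.lintegral_mul_norm_pow_le (measurable_ballPow p r).aemeasurable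
          (measurable_ballPow p' r).aemeasurable ha hb hab
    _ ≤ ENNReal.ofReal (r ^ (-c)) ^ a * ENNReal.ofReal (r ^ (-c')) ^ b := by gcongr
    _ = ENNReal.ofReal (r ^ (-(a * c + b * c'))) := by
        rw [ENNReal.ofReal_rpow_of_pos (Real.rpow_pos_of_pos hr.1 _),
          ENNReal.ofReal_rpow_of_pos (Real.rpow_pos_of_pos hr.1 _),
          ← ENNReal.ofReal_mul (Real.rpow_nonneg (Real.rpow_nonneg hr.1.le _) _),
          ← Real.rpow_mul hr.1.le, ← Real.rpow_mul hr.1.le, ← Real.rpow_add hr.1]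
        ring_nf

variable {ρ : ℕ → ℝ} {C : EuclideanSpace ℝ (Fin k) → ℝ}

theorem convexOn_of_tendsto_momentExponent [∀ j, IsProbabilityMeasure (μ j)]
    (hρ : ∀ n, ρ n ∈ Ioo (0 : ℝ) 1)
    (hC : ∀ p, Tendsto (fun n => momentExponent μ ν (ρ n) p) atTop (𝓝 ((C p : ℝ) : EReal))) :
    ConvexOn ℝ univ C := by
  refine ⟨convex_univ, fun p _ p' _ a b ha hb hab => ?_⟩
  refine le_of_forall_pos_le_add fun ε hε => ?_
  have h (p) : ∀ᶠ n in atTop, momentExponent μ ν (ρ n) p ≤ ((C p + ε : ℝ) : EReal) :=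
    ((hC p).eventually_lt_const (by exact_mod_cast lt_add_of_pos_right _ hε)).mono
      fun _ => le_of_lt
  have hle := le_of_tendsto (hC (a • p + b • p')) <| ((h p).and (h p')).mono fun n hn =>
    momentExponent_convex_combination_le (hρ n) ha hb hab hn.1 hn.2
  have hle := EReal.coe_le_coe_iff.1 hle
  have : a * (C p + ε) + b * (C p' + ε) = a * C p + b * C p' + (a + b) * ε := by ring
  rw [this, hab, one_mul] at hle
  simpa using hle

theorem eq_zero_at_zero_of_tendsto_momentExponent [IsProbabilityMeasure ν]
    (hν : ν (vsupport μ)ᶜ = 0)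
    (hC : ∀ p, Tendsto (fun n => momentExponent μ ν (ρ n) p) atTop (𝓝 ((C p : ℝ) : EReal))) :
    C 0 = 0 := by
  have h1 : ν (vsupport μ) = 1 := (prob_compl_eq_zero_iff measurableSet_vsupport).1 hν
  have h : ∀ n, momentExponent μ ν (ρ n) 0 = 0 := fun n => by
    simp [momentExponent, ballPow, h1]
  have := tendsto_nhds_unique (hC 0) ((tendsto_congr h).2 tendsto_const_nhds)
  exact_mod_cast this

theorem convexOn_axisRestrict (hC : ConvexOn ℝ univ C) (j : Fin k) :
    ConvexOn ℝ univ (axisRestrict C j) := by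
  refine ⟨convex_univ, fun s _ s' _ a b ha hb hab => ?_⟩
  have h : (EuclideanSpace.single j (a • s + b • s') : EuclideanSpace ℝ (Fin k)) =
      a • EuclideanSpace.single j s + b • EuclideanSpace.single j s' := by
    ext i
    by_cases hi : i = j <;> simp [hi]
  simpa only [axisRestrict, h] using hC.2 (mem_univ (EuclideanSpace.single j s))
    (mem_univ (EuclideanSpace.single j s')) ha hb hab

/-- Markov's inequality and the Borel–Cantelli lemma along the scales `ρ n`. -/
theorem ae_eventually_ballPow_lt [∀ j, IsProbabilityMeasure (μ j)] [IsProbabilityMeasure ν]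
    (hν : ν (vsupport μ)ᶜ = 0) (hρ : ∀ n, ρ n ∈ Ioo (0 : ℝ) 1)
    (hρ_sum : ∀ ε : ℝ, 0 < ε → Summable fun n => (ρ n) ^ ε) {p : EuclideanSpace ℝ (Fin k)}
    {L c : ℝ} (hL : Tendsto (fun n => momentExponent μ ν (ρ n) p) atTop (𝓝 (L : EReal)))
    (hc : L < c) :
    ∀ᵐ x ∂ν, ∀ᶠ n in atTop, ballPow μ p x (ρ n) < ENNReal.ofReal (ρ n ^ (-c)) := by
  obtain ⟨c₁, hLc, hcc⟩ := exists_between hc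
  have hres : ν.restrict (vsupport μ) = ν :=
    Measure.restrict_eq_self_of_ae_mem (ae_iff.2 hν)
  set A : ℕ → Set (EuclideanSpace ℝ (Fin d)) :=
    fun n => {x | ENNReal.ofReal (ρ n ^ (-c)) ≤ ballPow μ p x (ρ n)} with hA
  have hAle : ∀ᶠ n in atTop, ν.real (A n) ≤ ρ n ^ (c - c₁) := by
    filter_upwards [hL.eventually_lt_const (EReal.coe_lt_coe_iff.2 hLc)] with n hn
    have h1 := (momentExponent_le_iff (hρ n) p c₁).1 hn.le
    rw [hres] at h1
    have hpos : 0 < ρ n ^ (-c) := Real.rpow_pos_of_pos (hρ n).1 _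
    have h2 : ν (A n) ≤ ENNReal.ofReal (ρ n ^ (c - c₁)) := by
      refine (meas_ge_le_lintegral_div (measurable_ballPow p (ρ n)).aemeasurable
        (ENNReal.ofReal_pos.2 hpos).ne' ENNReal.ofReal_ne_top).trans ?_
      refine (ENNReal.div_le_div_right h1 _).trans_eq ?_
      rw [← ENNReal.ofReal_div_of_pos hpos, ← Real.rpow_sub (hρ n).1]
      ring_nf
    exact ENNReal.toReal_le_of_le_ofReal (Real.rpow_nonneg (hρ n).1.le _) h2
  have hsum : Summable fun n => ν.real (A n) :=
    (hρ_sum _ (sub_pos.2 hcc)).of_norm_bounded_eventually_nat <| hAle.mono fun n hn => by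
      rwa [Real.norm_of_nonneg measureReal_nonneg]
  have hne : ∑' n, ν (A n) ≠ ∞ := by
    have : ∀ n, ν (A n) = ENNReal.ofReal (ν.real (A n)) := fun n =>
      (ofReal_measureReal (measure_ne_top _ _)).symm
    simp_rw [this]
    exact hsum.tsum_ofReal_ne_top
  filter_upwards [ae_eventually_notMem hne] with x hx
  filter_upwards [hx] with n hn
  simpa [hA] using hn

end Moments

/-! ### Local dimensions of the `μ j` at `ν`-almost every point -/

section Interpolation

variable {ρ : ℕ → ℝ} {a : ℝ → ℝ}

theorem exists_scale_bracket (hρ_lim : Tendsto ρ atTop (𝓝 0)) (N : ℕ) {r : ℝ} (hr : 0 < r)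
    (hrN : r < ρ N) : ∃ n, N ≤ n ∧ ρ (n + 1) ≤ r ∧ r < ρ n := by
  by_contra! h
  have hall : ∀ n, N ≤ n → r < ρ n := by
    intro n hn
    induction n, hn using Nat.le_induction with
    | base => exact hrN
    | succ n hn ih =>
      by_contra! h'
      exact absurd ih (h n hn h').not_gt
  obtain ⟨n, hn⟩ := ((hρ_lim.eventually_lt_const hr).and (eventually_ge_atTop N)).exists
  exact lt_asymm hn.1 (hall n hn.2)

/-- A lower bound for `log m(B(x,r)) / log r` along the scales `ρ n` extends to all `r ↓ 0`;
here `a r` stands for `log m(B(x,r))`. -/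
theorem eventually_lt_div_log_of_scales (hρ : ∀ n, ρ n ∈ Ioo (0 : ℝ) 1)
    (hρ_lim : Tendsto ρ atTop (𝓝 0))
    (hρ_log : Tendsto (fun n => Real.log (ρ (n + 1)) / Real.log (ρ n)) atTop (𝓝 1))
    (ha : ∀ r, 0 < r → a r ≤ 0) (hmono : ∀ r r', 0 < r → r ≤ r' → a r ≤ a r') {c c' : ℝ}
    (hc : ∀ᶠ n in atTop, c ≤ a (ρ n) / Real.log (ρ n)) (hcc : c' < c) :
    ∀ᶠ r in 𝓝[>] (0 : ℝ), c' < a r / Real.log r := by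
  have hratio : ∀ᶠ n in atTop, c' * (Real.log (ρ (n + 1)) / Real.log (ρ n)) < c := by
    have := hρ_log.const_mul c'
    rw [mul_one] at this
    exact this.eventually_lt_const hcc
  obtain ⟨N, hN⟩ := eventually_atTop.1 (hc.and hratio)
  filter_upwards [Ioo_mem_nhdsGT (hρ N).1] with r hr
  obtain ⟨n, hn, h1, h2⟩ := exists_scale_bracket hρ_lim N hr.1 hr.2
  have hln : Real.log (ρ n) < 0 := Real.log_neg (hρ n).1 (hρ n).2
  have hlr : Real.log r < 0 := Real.log_neg hr.1 (h2.trans (hρ n).2)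
  -- The scale comparison needs `c' ≥ 0`; negative `c'` are trivial as the quotient is nonnegative.
  rcases lt_or_ge c' 0 with h0 | h0
  · exact h0.trans_le (div_nonneg_of_nonpos (ha r hr.1) hlr.le)
  obtain ⟨hc, hratio⟩ := hN n hn
  rw [le_div_iff_of_neg hln] at hc
  rw [← mul_div_assoc, div_lt_iff_of_neg hln] at hratio
  rw [lt_div_iff_of_neg hlr]
  calc a r ≤ a (ρ n) := hmono _ _ hr.1 h2.le
    _ ≤ c * Real.log (ρ n) := hc
    _ < c' * Real.log (ρ (n + 1)) := hratio
    _ ≤ c' * Real.log r := mul_le_mul_of_nonneg_left (Real.log_le_log (hρ _).1 h1) h0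

/-- The upper-bound counterpart of `eventually_lt_div_log_of_scales`. -/
theorem eventually_div_log_lt_of_scales (hρ : ∀ n, ρ n ∈ Ioo (0 : ℝ) 1)
    (hρ_lim : Tendsto ρ atTop (𝓝 0))
    (hρ_log : Tendsto (fun n => Real.log (ρ (n + 1)) / Real.log (ρ n)) atTop (𝓝 1))
    (ha : ∀ r, 0 < r → a r ≤ 0) (hmono : ∀ r r', 0 < r → r ≤ r' → a r ≤ a r') {c c' : ℝ}
    (hc : ∀ᶠ n in atTop, a (ρ n) / Real.log (ρ n) ≤ c) (hcc : c < c') :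
    ∀ᶠ r in 𝓝[>] (0 : ℝ), a r / Real.log r < c' := by
  have hratio : ∀ᶠ n in atTop, c * (Real.log (ρ (n + 1)) / Real.log (ρ n)) < c' := by
    have := hρ_log.const_mul c
    rw [mul_one] at this
    exact this.eventually_lt_const hcc
  obtain ⟨N, hN⟩ := eventually_atTop.1 (hc.and hratio)
  filter_upwards [Ioo_mem_nhdsGT (hρ N).1] with r hr
  obtain ⟨n, hn, h1, h2⟩ := exists_scale_bracket hρ_lim N hr.1 hr.2
  have hln : Real.log (ρ n) < 0 := Real.log_neg (hρ n).1 (hρ n).2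
  have hln' : Real.log (ρ (n + 1)) < 0 := Real.log_neg (hρ _).1 (hρ _).2
  have hlr : Real.log r < 0 := Real.log_neg hr.1 (h2.trans (hρ n).2)
  have hc := (hN (n + 1) (hn.trans n.le_succ)).1
  have hratio := (hN n hn).2
  have hc0 : 0 < c' :=
    ((div_nonneg_of_nonpos (ha _ (hρ (n + 1)).1) hln'.le).trans hc).trans_lt hcc
  rw [div_le_iff_of_neg hln'] at hc
  rw [← mul_div_assoc, div_lt_iff_of_neg hln] at hratio
  rw [div_lt_iff_of_neg hlr]
  calc c' * Real.log r ≤ c' * Real.log (ρ n) :=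
        mul_le_mul_of_nonneg_left (Real.log_le_log hr.1 h2.le) hc0.le
    _ < c * Real.log (ρ (n + 1)) := hratio
    _ ≤ a (ρ (n + 1)) := hc
    _ ≤ a r := hmono _ _ (hρ _).1 h1

end Interpolation

section LocalDimension

variable {d k : ℕ} {μ : Fin k → Measure (EuclideanSpace ℝ (Fin d))}
  {ν : Measure (EuclideanSpace ℝ (Fin d))} {ρ : ℕ → ℝ} {C : EuclideanSpace ℝ (Fin k) → ℝ}

theorem exists_pos_lt_mul_of_hasDerivWithinAt {g : ℝ → ℝ} {D D' : ℝ} (h0 : g 0 = 0)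
    (hg : HasDerivWithinAt g D (Ioi 0) 0) (hD : D < D') : ∃ s, 0 < s ∧ g s < s * D' := by
  have h := (hasDerivWithinAt_iff_tendsto_slope' (self_notMem_Ioi)).1 hg
  obtain ⟨s, hs, hs0⟩ := ((h.eventually_lt_const hD).and self_mem_nhdsWithin).exists
  have hs0 : 0 < s := hs0
  refine ⟨s, hs0, ?_⟩
  rwa [slope_def_field, h0, sub_zero, sub_zero, div_lt_iff₀' hs0] at hs

theorem exists_neg_lt_mul_of_hasDerivWithinAt {g : ℝ → ℝ} {D D' : ℝ} (h0 : g 0 = 0)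
    (hg : HasDerivWithinAt g D (Iio 0) 0) (hD : D' < D) : ∃ s, s < 0 ∧ g s < s * D' := by
  have h := (hasDerivWithinAt_iff_tendsto_slope' (self_notMem_Iio)).1 hg
  obtain ⟨s, hs, hs0⟩ := ((h.eventually_const_lt hD).and self_mem_nhdsWithin).exists
  have hs0 : s < 0 := hs0
  refine ⟨s, hs0, ?_⟩
  rwa [slope_def_field, h0, sub_zero, sub_zero, lt_div_iff_of_neg hs0, mul_comm] at hs

/-- Reading the Borel–Cantelli bound at the exponent `p = s e_j`. -/
theorem neg_lt_mul_div_log_of_ballPow_single_lt [∀ j, IsProbabilityMeasure (μ j)]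
    {x : EuclideanSpace ℝ (Fin d)} (hx : x ∈ vsupport μ) {r : ℝ} (hr : r ∈ Ioo (0 : ℝ) 1)
    {j : Fin k} {s c : ℝ}
    (h : ballPow μ (EuclideanSpace.single j s) x r < ENNReal.ofReal (r ^ (-c))) :
    -c < s * (Real.log ((μ j).real (Metric.closedBall x r)) / Real.log r) := by
  rw [ballPow_eq_ofReal_exp hx hr.1, Real.rpow_def_of_pos hr.1,
    ENNReal.ofReal_lt_ofReal_iff (Real.exp_pos _), Real.exp_lt_exp,
    Finset.sum_eq_single j (fun i _ hi => by simp [hi]) (by simp)] at h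
  rw [← mul_div_assoc, lt_div_iff_of_neg (Real.log_neg hr.1 hr.2)]
  simpa [mul_comm] using h

/-- At `ν`-almost every point the local dimensions of `μ j` lie between the negatives of the right
and left derivatives of `s ↦ C (s e_j)` at `0`. -/
theorem ae_local_dim_bounds [∀ j, IsProbabilityMeasure (μ j)] [IsProbabilityMeasure ν]
    (hν : ν (vsupport μ)ᶜ = 0) (hρ : ∀ n, ρ n ∈ Ioo (0 : ℝ) 1)
    (hρ_lim : Tendsto ρ atTop (𝓝 0))
    (hρ_log : Tendsto (fun n => Real.log (ρ (n + 1)) / Real.log (ρ n)) atTop (𝓝 1))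
    (hρ_sum : ∀ ε : ℝ, 0 < ε → Summable fun n => (ρ n) ^ ε)
    (hC : ∀ p, Tendsto (fun n => momentExponent μ ν (ρ n) p) atTop (𝓝 ((C p : ℝ) : EReal)))
    (j : Fin k) {D D' : ℝ} (hD : HasDerivWithinAt (axisRestrict C j) D (Ioi 0) 0)
    (hD' : HasDerivWithinAt (axisRestrict C j) D' (Iio 0) 0) {η : ℝ} (hη : 0 < η) :
    ∀ᵐ x ∂ν, ∀ᶠ r in 𝓝[>] (0 : ℝ),
      -D - η < Real.log ((μ j).real (Metric.closedBall x r)) / Real.log r ∧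
        Real.log ((μ j).real (Metric.closedBall x r)) / Real.log r < -D' + η := by
  have h0 : axisRestrict C j 0 = 0 := by
    have : (EuclideanSpace.single j (0 : ℝ) : EuclideanSpace ℝ (Fin k)) = 0 := by
      ext i
      simp
    rw [axisRestrict, this, eq_zero_at_zero_of_tendsto_momentExponent hν hC]
  obtain ⟨s, hs, hsC⟩ := exists_pos_lt_mul_of_hasDerivWithinAt h0 hD
    (lt_add_of_pos_right D (half_pos hη))
  obtain ⟨s', hs', hsC'⟩ := exists_neg_lt_mul_of_hasDerivWithinAt h0 hD'
    (sub_lt_self D' (half_pos hη))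
  filter_upwards [ae_eventually_ballPow_lt hν hρ hρ_sum (hC _) hsC,
    ae_eventually_ballPow_lt hν hρ hρ_sum (hC _) hsC', ae_iff.2 hν] with x h1 h2 hx
  have ha : ∀ r, 0 < r → Real.log ((μ j).real (Metric.closedBall x r)) ≤ 0 := fun r _ =>
    Real.log_nonpos measureReal_nonneg measureReal_le_one
  have hmono : ∀ r r', 0 < r → r ≤ r' → Real.log ((μ j).real (Metric.closedBall x r)) ≤
      Real.log ((μ j).real (Metric.closedBall x r')) := fun r r' hr hrr =>
    Real.log_le_log (measureReal_closedBall_pos hx hr j)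
      (measureReal_mono (Metric.closedBall_subset_closedBall hrr))
  refine Eventually.and
    (eventually_lt_div_log_of_scales (c := -D - η / 2) hρ hρ_lim hρ_log ha hmono ?_ (by linarith))
    (eventually_div_log_lt_of_scales (c := -D' + η / 2) hρ hρ_lim hρ_log ha hmono ?_
      (by linarith))
  · filter_upwards [h1] with n hn
    have := neg_lt_mul_div_log_of_ballPow_single_lt hx (hρ n) hn
    rw [← mul_neg] at this
    linarith [lt_of_mul_lt_mul_left this hs.le]
  · filter_upwards [h2] with n hn
    have := neg_lt_mul_div_log_of_ballPow_single_lt hx (hρ n) hn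
    rw [← mul_neg] at this
    linarith [lt_of_mul_lt_mul_of_nonpos_left this hs'.le]

theorem coe_le_liminf_of_forall_sub_lt {f : ℝ → ℝ} {l : Filter ℝ} {α : ℝ}
    (h : ∀ n : ℕ, ∀ᶠ r in l, α - 1 / ((n : ℝ) + 1) < f r) :
    (α : EReal) ≤ liminf (fun r => (f r : EReal)) l := by
  rw [le_liminf_iff]
  intro y hy
  obtain ⟨c, hyc, hcα⟩ := EReal.lt_iff_exists_real_btwn.1 hy
  obtain ⟨n, hn⟩ := exists_nat_one_div_lt (sub_pos.2 (EReal.coe_lt_coe_iff.1 hcα))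
  filter_upwards [h n] with r hr
  exact hyc.trans (EReal.coe_lt_coe_iff.2 (by linarith))

theorem limsup_le_coe_of_forall_lt_add {f : ℝ → ℝ} {l : Filter ℝ} {α : ℝ}
    (h : ∀ n : ℕ, ∀ᶠ r in l, f r < α + 1 / ((n : ℝ) + 1)) :
    limsup (fun r => (f r : EReal)) l ≤ (α : EReal) := by
  rw [limsup_le_iff]
  intro y hy
  obtain ⟨c, hαc, hcy⟩ := EReal.lt_iff_exists_real_btwn.1 hy
  obtain ⟨n, hn⟩ := exists_nat_one_div_lt (sub_pos.2 (EReal.coe_lt_coe_iff.1 hαc))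
  filter_upwards [h n] with r hr
  exact lt_trans (EReal.coe_lt_coe_iff.2 (by linarith)) hcy

theorem ae_mem_level_inter [∀ j, IsProbabilityMeasure (μ j)] [IsProbabilityMeasure ν]
    (hν : ν (vsupport μ)ᶜ = 0) (hρ : ∀ n, ρ n ∈ Ioo (0 : ℝ) 1)
    (hρ_lim : Tendsto ρ atTop (𝓝 0))
    (hρ_log : Tendsto (fun n => Real.log (ρ (n + 1)) / Real.log (ρ n)) atTop (𝓝 1))
    (hρ_sum : ∀ ε : ℝ, 0 < ε → Summable fun n => (ρ n) ^ ε)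
    (hC : ∀ p, Tendsto (fun n => momentExponent μ ν (ρ n) p) atTop (𝓝 ((C p : ℝ) : EReal)))
    (hd : ∀ j, DifferentiableWithinAt ℝ (axisRestrict C j) (Ioi 0) 0 ∧
      DifferentiableWithinAt ℝ (axisRestrict C j) (Iio 0) 0) :
    ∀ᵐ x ∂ν, x ∈ lowerLevel μ (-rightGrad C) ∩ upperLevel μ (-leftGrad C) := by
  have h : ∀ᵐ x ∂ν, ∀ j : Fin k, ∀ n : ℕ, ∀ᶠ r in 𝓝[>] (0 : ℝ),
      -rightGrad C j - 1 / ((n : ℝ) + 1) <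
          Real.log ((μ j).real (Metric.closedBall x r)) / Real.log r ∧
        Real.log ((μ j).real (Metric.closedBall x r)) / Real.log r <
          -leftGrad C j + 1 / ((n : ℝ) + 1) := by
    refine ae_all_iff.2 fun j => ae_all_iff.2 fun n => ?_
    exact ae_local_dim_bounds hν hρ hρ_lim hρ_log hρ_sum hC j (hd j).1.hasDerivWithinAt
      (hd j).2.hasDerivWithinAt Nat.one_div_pos_of_nat
  filter_upwards [h, ae_iff.2 hν] with x h hx
  exact ⟨⟨hx, fun j => coe_le_liminf_of_forall_sub_lt fun n => (h j n).mono fun _ hr => hr.1⟩,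
    ⟨hx, fun j => limsup_le_coe_of_forall_lt_add fun n => (h j n).mono fun _ hr => hr.2⟩⟩

end LocalDimension

/-! ### Hausdorff dimension of sets with prescribed ball growth -/

section Dimension

variable {d k : ℕ} {μ : Fin k → Measure (EuclideanSpace ℝ (Fin d))}
  {ν : Measure (EuclideanSpace ℝ (Fin d))}

/-- Mass distribution principle. -/
theorem le_dimH_of_eventually_measure_closedBall_le {E : Set (EuclideanSpace ℝ (Fin d))}
    (hE : ν E ≠ 0) {s : ℝ≥0}
    (h : ∀ x ∈ E, ∀ᶠ r in 𝓝[>] (0 : ℝ),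
      ν (Metric.closedBall x r) ≤ ENNReal.ofReal (r ^ (s : ℝ))) :
    (s : ℝ≥0∞) ≤ dimH E := by
  -- `A n` collects the points where the bound holds uniformly below the radius `1 / (n + 1)`.
  set A : ℕ → Set (EuclideanSpace ℝ (Fin d)) := fun n => {x ∈ E | ∀ r ∈ Ioo (0 : ℝ) (1 / (n + 1)),
    ν (Metric.closedBall x r) ≤ ENNReal.ofReal (r ^ (s : ℝ))} with hA
  have hEA : E ⊆ ⋃ n, A n := by
    intro x hx
    obtain ⟨u, hu, hur⟩ := mem_nhdsGT_iff_exists_Ioo_subset.1 (h x hx)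
    obtain ⟨n, hn⟩ := exists_nat_one_div_lt (mem_Ioi.1 hu)
    exact mem_iUnion.2 ⟨n, hx, fun r hr => hur ⟨hr.1, hr.2.trans hn⟩⟩
  obtain ⟨n, hn⟩ : ∃ n, ν (A n) ≠ 0 := by
    by_contra! h0
    exact hE (measure_mono_null hEA (measure_iUnion_null h0))
  have hpos : (0 : ℝ) < 1 / ((n : ℝ) + 1) := Nat.one_div_pos_of_nat
  have hle : ν.restrict (A n) ≤ μH[(s : ℝ)] := by
    refine Measure.le_hausdorffMeasure _ _ (ENNReal.ofReal (1 / ((n : ℝ) + 1) / 2))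
      (ENNReal.ofReal_pos.2 (half_pos hpos)) fun U hU => ?_
    have hfin : Metric.ediam U ≠ ∞ := (hU.trans_lt ENNReal.ofReal_lt_top).ne
    -- `A n` need not be measurable; the closure, of the same diameter, is.
    have hclosure : ν.restrict (A n) U ≤ ν (closure U ∩ A n) :=
      (measure_mono subset_closure).trans_eq
        (Measure.restrict_apply isClosed_closure.measurableSet)
    refine hclosure.trans ?_
    rcases (closure U ∩ A n).eq_empty_or_nonempty with h0 | ⟨x, hxU, hxA⟩
    · simp [h0]
    -- Radii strictly larger than the diameter avoid the degenerate ball of radius zero.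
    set δ := (Metric.ediam U).toReal with hδ
    have hδlt : δ < 1 / ((n : ℝ) + 1) := by
      have : δ ≤ 1 / ((n : ℝ) + 1) / 2 := ENNReal.toReal_le_of_le_ofReal (half_pos hpos).le hU
      linarith
    have hev : ∀ᶠ r in 𝓝[>] δ, ν (closure U ∩ A n) ≤ ENNReal.ofReal (r ^ (s : ℝ)) := by
      filter_upwards [Ioo_mem_nhdsGT hδlt] with r hr
      refine (measure_mono ?_).trans (hxA.2 r ⟨ENNReal.toReal_nonneg.trans_lt hr.1, hr.2⟩)
      intro y hy
      have hb : Bornology.IsBounded (closure U) :=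
        Metric.isBounded_iff_ediam_ne_top.2 (by rwa [Metric.ediam_closure])
      have h1 := Metric.dist_le_diam_of_mem hb hy.1 hxU
      rw [Metric.diam, Metric.ediam_closure] at h1
      exact h1.trans hr.1.le
    have hlim : Tendsto (fun r : ℝ => ENNReal.ofReal (r ^ (s : ℝ))) (𝓝[>] δ)
        (𝓝 (ENNReal.ofReal (δ ^ (s : ℝ)))) :=
      (ENNReal.continuous_ofReal.comp
        (Real.continuous_rpow_const s.coe_nonneg)).continuousAt.mono_left nhdsWithin_le_nhds
    refine (ge_of_tendsto hlim hev).trans_eq ?_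
    rw [hδ, ← ENNReal.ofReal_rpow_of_nonneg ENNReal.toReal_nonneg s.coe_nonneg,
      ENNReal.ofReal_toReal hfin]
  refine (le_dimH_of_hausdorffMeasure_ne_zero (s := A n) fun h0 => hn ?_).trans
    (dimH_mono fun x hx => hx.1)
  have := hle (A n)
  rw [h0] at this
  simpa using this

/-- If the mixed Hausdorff measure `H^{p,t}` of the support vanishes and `μ(B(x,r))^p` is at least
of the order `r^A` on `E`, then the dimension of `E` is at most `A + t`. Nonemptiness of `E` rules
out the case `A + t < 0`, in which no centred covering can have a small sum. -/
theorem dimH_le_of_mixedHausdorff_eq_zero [∀ j, IsProbabilityMeasure (μ j)]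
    {E : Set (EuclideanSpace ℝ (Fin d))} (hES : E ⊆ vsupport μ) (hne : E.Nonempty)
    {p : EuclideanSpace ℝ (Fin k)} {t A : ℝ} (ht : mixedHausdorff μ p t (vsupport μ) = 0)
    (h : ∀ x ∈ E, ∀ δ, 0 < δ → ∀ᶠ r in 𝓝[>] (0 : ℝ),
      ∑ j, p j * (Real.log ((μ j).real (Metric.closedBall x r)) / Real.log r) ≤ A + δ) :
    ((dimH E : ℝ≥0∞) : EReal) ≤ ((A + t : ℝ) : EReal) := by
  suffices H : ∀ δ, 0 < δ → ((dimH E : ℝ≥0∞) : EReal) ≤ ((A + δ + t : ℝ) : EReal) by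
    refine le_of_forall_gt_imp_ge_of_dense fun y hy => ?_
    obtain ⟨c, hc, hcy⟩ := EReal.lt_iff_exists_real_btwn.1 hy
    have hc := EReal.coe_lt_coe_iff.1 hc
    refine (H (c - (A + t)) (sub_pos.2 hc)).trans ?_
    ring_nf
    exact hcy.le
  intro δ hδ
  set w := A + δ + t with hw
  -- `F n` collects the points where `r ^ (A + δ) ≤ μ(B(x,r))^p` for all `r < 1 / (n + 1)`.
  set F : ℕ → Set (EuclideanSpace ℝ (Fin d)) := fun n => {x ∈ E | ∀ r ∈ Ioo (0 : ℝ) (1 / (n + 1)),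
    ENNReal.ofReal (r ^ (A + δ)) ≤ ballPow μ p x r} with hF
  have hEF : E ⊆ ⋃ n, F n := by
    intro x hx
    have hev : ∀ᶠ r in 𝓝[>] (0 : ℝ), ENNReal.ofReal (r ^ (A + δ)) ≤ ballPow μ p x r := by
      filter_upwards [h x hx δ hδ, Ioo_mem_nhdsGT one_pos] with r hr hr1
      have hlog := Real.log_neg hr1.1 hr1.2
      rw [ballPow_eq_ofReal_exp (hES hx) hr1.1, Real.rpow_def_of_pos hr1.1]
      refine ENNReal.ofReal_le_ofReal (Real.exp_le_exp.2 ?_)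
      simp_rw [← mul_div_assoc] at hr
      rw [← Finset.sum_div, div_le_iff_of_neg hlog] at hr
      linarith
    obtain ⟨u, hu, hur⟩ := mem_nhdsGT_iff_exists_Ioo_subset.1 hev
    obtain ⟨n, hn⟩ := exists_nat_one_div_lt (mem_Ioi.1 hu)
    exact mem_iUnion.2 ⟨n, hx, fun r hr => hur ⟨hr.1, hr.2.trans hn⟩⟩
  have hcover : ∀ n, ∀ ε > 0, ∀ η : ℝ≥0∞, η ≠ 0 → ∃ D, IsCenteredCovering ε (F n) D ∧
      ∑' P : D, ENNReal.ofReal ((2 * P.1.2) ^ w) ≤ η := by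
    intro n ε hε η hη
    have hpos : (0 : ℝ) < 1 / ((n : ℝ) + 1) := Nat.one_div_pos_of_nat
    have h0 : preHausdorff μ p t (F n) = 0 := by
      refine le_antisymm (ht ▸ le_iSup₂_of_le (F n) (fun x hx => hES hx.1) le_rfl) zero_le
    have hK : (0 : ℝ) < 2 ^ (A + δ) := by positivity
    set K := ENNReal.ofReal (2 ^ (A + δ)) with hKdef
    have hK0 : K ≠ 0 := (ENNReal.ofReal_pos.2 hK).ne'
    have hlt : (⨅ (D : Set (EuclideanSpace ℝ (Fin d) × ℝ))
        (_ : IsCenteredCovering (min ε (1 / ((n : ℝ) + 1))) (F n) D), ballSum μ p t D) < η / K := by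
      refine lt_of_le_of_lt ?_ (ENNReal.div_pos hη ENNReal.ofReal_ne_top)
      rw [← h0]
      exact le_iSup₂_of_le (f := fun (ε : ℝ) (_ : 0 < ε) =>
          ⨅ (C : Set (EuclideanSpace ℝ (Fin d) × ℝ))
            (_ : IsCenteredCovering ε (F n) C), ballSum μ p t C) _ (lt_min hε hpos) le_rfl
    obtain ⟨D, hlt⟩ := iInf_lt_iff.1 hlt
    obtain ⟨hD, hlt⟩ := iInf_lt_iff.1 hlt
    refine ⟨D, ⟨hD.1, fun P hP => ⟨(hD.2.1 P hP).1, (hD.2.1 P hP).2.1,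
      (hD.2.1 P hP).2.2.trans_le (min_le_left _ _)⟩, hD.2.2⟩, ?_⟩
    calc ∑' P : D, ENNReal.ofReal ((2 * P.1.2) ^ w)
        ≤ ∑' P : D, K * (ballPow μ p P.1.1 P.1.2 * ENNReal.ofReal ((2 * P.1.2) ^ t)) := by
          refine ENNReal.tsum_le_tsum fun P => ?_
          obtain ⟨hPF, hP0, hPr⟩ := hD.2.1 P.1 P.2
          have hb := hPF.2 P.1.2 ⟨hP0, hPr.trans_le (min_le_right _ _)⟩
          calc ENNReal.ofReal ((2 * P.1.2) ^ w)
              = K * (ENNReal.ofReal (P.1.2 ^ (A + δ)) * ENNReal.ofReal ((2 * P.1.2) ^ t)) := by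
                rw [hw, Real.rpow_add (by positivity), Real.mul_rpow zero_le_two hP0.le,
                  ENNReal.ofReal_mul (by positivity), ENNReal.ofReal_mul hK.le, mul_assoc]
            _ ≤ _ := by gcongr
      _ = K * ballSum μ p t D := ENNReal.tsum_mul_left
      _ ≤ K * (η / K) := by gcongr
      _ = η := ENNReal.mul_div_cancel hK0 ENNReal.ofReal_ne_top
  have hw0 : 0 ≤ w := by
    by_contra! hneg
    obtain ⟨x, hx⟩ := hne
    obtain ⟨n, hn⟩ := mem_iUnion.1 (hEF hx)
    -- A single ball of radius below `1 / 2` already contributes at least `1` to the sum.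
    obtain ⟨D, hD, hsum⟩ := hcover n (1 / 2) (by norm_num) (1 / 2) (by simp)
    obtain ⟨P, hP, -⟩ := mem_iUnion₂.1 (hD.2.2 hn)
    obtain ⟨-, hP0, hP1⟩ := hD.2.1 P hP
    have h1 : (1 : ℝ≥0∞) ≤ ENNReal.ofReal ((2 * P.2) ^ w) := by
      rw [ENNReal.one_le_ofReal]
      exact Real.one_le_rpow_of_pos_of_le_one_of_nonpos (by positivity) (by linarith) hneg.le
    have h2 := (h1.trans (ENNReal.le_tsum
      (f := fun P : D => ENNReal.ofReal ((2 * P.1.2) ^ w)) ⟨P, hP⟩)).trans hsum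
    exact absurd h2 (not_le.2 (by simp))
  have hdim : dimH E ≤ (w.toNNReal : ℝ≥0∞) := by
    refine (dimH_mono hEF).trans ?_
    rw [dimH_iUnion]
    refine iSup_le fun n => dimH_le_of_hausdorffMeasure_ne_top ?_
    rw [Real.coe_toNNReal w hw0]
    have hu : ∀ i : ℕ, (0 : ℝ) < 1 / ((i : ℝ) + 1) := fun i => Nat.one_div_pos_of_nat
    choose D hD hsum using fun i : ℕ => hcover n (1 / ((i : ℝ) + 1)) (hu i)
      (ENNReal.ofReal (1 / ((i : ℝ) + 1))) (ENNReal.ofReal_pos.2 (hu i)).ne'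
    have : ∀ i, Countable (D i) := fun i => (hD i).1.to_subtype
    have hlim : Tendsto (fun i : ℕ => ENNReal.ofReal (1 / ((i : ℝ) + 1))) atTop (𝓝 0) := by
      simpa using ENNReal.tendsto_ofReal tendsto_one_div_add_atTop_nhds_zero_nat
    have hlim2 : Tendsto (fun i : ℕ => 2 * ENNReal.ofReal (1 / ((i : ℝ) + 1))) atTop (𝓝 0) := by
      simpa using ENNReal.Tendsto.const_mul hlim (Or.inr ENNReal.ofNat_ne_top)
    have hdiam : ∀ i (P : D i), Metric.ediam (Metric.closedBall P.1.1 P.1.2) ≤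
        ENNReal.ofReal (2 * P.1.2) := by
      intro i P
      have hP0 := ((hD i).2.1 P.1 P.2).2.1
      rw [← Metric.closedEBall_ofReal hP0.le, ENNReal.ofReal_mul zero_le_two, ENNReal.ofReal_ofNat]
      exact Metric.ediam_closedEBall_le
    have hle := Measure.hausdorffMeasure_le_liminf_tsum w (F n) (l := atTop) _ hlim2
      (fun i (P : D i) => Metric.closedBall P.1.1 P.1.2)
      (Eventually.of_forall fun i P => (hdiam i P).trans (by
        rw [ENNReal.ofReal_mul zero_le_two, ENNReal.ofReal_ofNat]
        gcongr
        exact ((hD i).2.1 P.1 P.2).2.2.le))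
      (Eventually.of_forall fun i x hx => by
        obtain ⟨P, hP, hxP⟩ := mem_iUnion₂.1 ((hD i).2.2 hx)
        exact mem_iUnion.2 ⟨⟨P, hP⟩, hxP⟩)
    refine (hle.trans ?_).trans_lt ENNReal.zero_lt_top |>.ne
    refine (liminf_le_liminf (Eventually.of_forall fun i => ?_)).trans hlim.liminf_eq.le
    refine (ENNReal.tsum_le_tsum fun P => ?_).trans (hsum i)
    have hP0 := ((hD i).2.1 P.1 P.2).2.1
    rw [← ENNReal.ofReal_rpow_of_nonneg (by positivity) hw0]
    exact ENNReal.rpow_le_rpow (hdiam i P) hw0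
  refine (EReal.coe_ennreal_le_coe_ennreal_iff.2 hdim).trans_eq ?_
  rw [EReal.coe_nnreal_eq_coe_real, Real.coe_toNNReal w hw0]

end Dimension

/-! ### Consequences of the Gibbs property of `ν` -/

section Gibbs

variable {d k : ℕ} {μ : Fin k → Measure (EuclideanSpace ℝ (Fin d))}
  {ν : Measure (EuclideanSpace ℝ (Fin d))} {q : EuclideanSpace ℝ (Fin k)}
  {t rq Klow Kup : ℝ} {φ : ℝ → ℝ}

theorem eventually_abs_add_abs_le_of_isLittleO_log (hφ : φ =o[𝓝[>] (0 : ℝ)] Real.log) (K : ℝ)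
    {δ : ℝ} (hδ : 0 < δ) : ∀ᶠ r in 𝓝[>] (0 : ℝ), |K| + |φ r| ≤ -(δ * Real.log r) := by
  have h1 := hφ.def (half_pos hδ)
  have h2 := Real.tendsto_log_nhdsGT_zero.eventually_le_atBot (-(2 * |K| / δ))
  filter_upwards [h1, h2] with r h1 h2
  have hlog : Real.log r ≤ 0 := h2.trans (neg_nonpos.2 (by positivity))
  rw [Real.norm_eq_abs, Real.norm_eq_abs, abs_of_nonpos hlog] at h1
  have h3 := mul_le_mul_of_nonneg_left h2 hδ.le
  rw [mul_neg, mul_div_cancel₀ _ hδ.ne'] at h3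
  linarith

/-- The lower Gibbs bound makes every centred packing sum at exponent `t + δ` small, being
dominated by the total `ν`-mass of disjoint balls times a power of the largest radius. -/
theorem prePacking_eq_zero_of_gibbs [∀ j, IsProbabilityMeasure (μ j)] [IsProbabilityMeasure ν]
    (hrq : 0 < rq) (hK : 0 < Klow) (hφ : φ =o[𝓝[>] (0 : ℝ)] Real.log)
    (hG : ∀ x ∈ vsupport μ, ∀ r ∈ Ioo (0 : ℝ) rq, Klow ≤ ν.real (Metric.closedBall x r) /
      ((∏ j, ((μ j).real (Metric.closedBall x r)) ^ (q j)) * (2 * r) ^ t * Real.exp (φ r)))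
    {δ : ℝ} (hδ : 0 < δ) : prePacking μ q (t + δ) (vsupport μ) = 0 := by
  have hbound : ∀ᶠ r in 𝓝[>] (0 : ℝ), ∀ x ∈ vsupport μ,
      ballPow μ q x r * ENNReal.ofReal ((2 * r) ^ (t + δ)) ≤
        ENNReal.ofReal (r ^ (δ / 2)) * ν (Metric.closedBall x r) := by
    filter_upwards [eventually_abs_add_abs_le_of_isLittleO_log hφ
      (δ * Real.log 2 - Real.log Klow) (half_pos hδ), Ioo_mem_nhdsGT hrq] with r hr hr1 x hx
    have hr0 := hr1.1
    set M := ∏ j, ((μ j).real (Metric.closedBall x r)) ^ (q j) with hM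
    have hM0 : 0 < M := Finset.prod_pos fun j _ =>
      Real.rpow_pos_of_pos (measureReal_closedBall_pos hx hr0 j) _
    have h2t : 0 < (2 * r) ^ t := by positivity
    have hGx := hG x hx r hr1
    rw [le_div_iff₀ (by positivity)] at hGx
    have hsmall : (2 * r) ^ δ ≤ r ^ (δ / 2) * (Klow * Real.exp (φ r)) := by
      rw [Real.rpow_def_of_pos (by positivity), Real.rpow_def_of_pos hr0,
        ← Real.exp_log hK, ← Real.exp_add, ← Real.exp_add, Real.exp_le_exp,
        Real.log_mul two_ne_zero hr0.ne']
      have h1 := le_abs_self (δ * Real.log 2 - Real.log Klow)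
      have h2 := neg_abs_le (φ r)
      linarith
    rw [ballPow_eq_ofReal_prod hx hr0, ← hM, ← ofReal_measureReal (measure_ne_top _ _),
      ← ENNReal.ofReal_mul hM0.le, ← ENNReal.ofReal_mul (by positivity)]
    refine ENNReal.ofReal_le_ofReal ?_
    calc M * (2 * r) ^ (t + δ) = M * (2 * r) ^ t * (2 * r) ^ δ := by
          rw [Real.rpow_add (by positivity), mul_assoc]
      _ ≤ M * (2 * r) ^ t * (r ^ (δ / 2) * (Klow * Real.exp (φ r))) := by gcongr
      _ = r ^ (δ / 2) * (Klow * (M * (2 * r) ^ t * Real.exp (φ r))) := by ring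
      _ ≤ _ := by gcongr
  obtain ⟨u, hu, hur⟩ := mem_nhdsGT_iff_exists_Ioo_subset.1 hbound
  have hu : 0 < u := hu
  have hle : ∀ ε ∈ Ioo 0 u, prePacking μ q (t + δ) (vsupport μ) ≤ ENNReal.ofReal (ε ^ (δ / 2)) := by
    intro ε hε
    refine iInf₂_le_of_le ε hε.1 (iSup₂_le fun D hD => ?_)
    have : Countable D := hD.1.to_subtype
    calc ballSum μ q (t + δ) D
        ≤ ∑' P : D, ENNReal.ofReal (ε ^ (δ / 2)) * ν (Metric.closedBall P.1.1 P.1.2) := by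
          refine ENNReal.tsum_le_tsum fun P => ?_
          obtain ⟨hPS, hP0, hPε⟩ := hD.2.1 P.1 P.2
          refine (hur ⟨hP0, hPε.trans hε.2⟩ P.1.1 hPS).trans ?_
          gcongr
      _ = ENNReal.ofReal (ε ^ (δ / 2)) * ∑' P : D, ν (Metric.closedBall P.1.1 P.1.2) :=
          ENNReal.tsum_mul_left
      _ ≤ ENNReal.ofReal (ε ^ (δ / 2)) * 1 := by
          gcongr
          refine (tsum_meas_le_meas_iUnion_of_disjoint ν
            (fun P : D => Metric.isClosed_closedBall.measurableSet) ?_).trans prob_le_one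
          exact fun P P' hne => hD.2.2 P.2 P'.2 fun h => hne (Subtype.ext h)
      _ = _ := mul_one _
  have hlim : Tendsto (fun ε : ℝ => ENNReal.ofReal (ε ^ (δ / 2))) (𝓝[>] 0) (𝓝 0) := by
    have h := (ENNReal.continuous_ofReal.comp
      (Real.continuous_rpow_const (half_pos hδ).le)).tendsto 0
    simp only [Function.comp_apply, Real.zero_rpow (half_pos hδ).ne', ENNReal.ofReal_zero] at h
    exact h.mono_left nhdsWithin_le_nhds
  refine le_antisymm (ge_of_tendsto hlim ?_) zero_le
  filter_upwards [Ioo_mem_nhdsGT hu] with ε hε using hle ε hε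

theorem LambdaDim_le_of_gibbs [∀ j, IsProbabilityMeasure (μ j)] [IsProbabilityMeasure ν]
    (hrq : 0 < rq) (hK : 0 < Klow) (hφ : φ =o[𝓝[>] (0 : ℝ)] Real.log)
    (hG : ∀ x ∈ vsupport μ, ∀ r ∈ Ioo (0 : ℝ) rq, Klow ≤ ν.real (Metric.closedBall x r) /
      ((∏ j, ((μ j).real (Metric.closedBall x r)) ^ (q j)) * (2 * r) ^ t * Real.exp (φ r))) :
    LambdaDim μ q ≤ (t : EReal) := by
  refine le_of_forall_gt_imp_ge_of_dense fun y hy => ?_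
  obtain ⟨c, hc, hcy⟩ := EReal.lt_iff_exists_real_btwn.1 hy
  have := prePacking_eq_zero_of_gibbs hrq hK hφ hG (sub_pos.2 (EReal.coe_lt_coe_iff.1 hc))
  rw [add_sub_cancel] at this
  have hΛc : LambdaDim μ q ≤ (c : EReal) := sInf_le ⟨c, this, rfl⟩
  exact hΛc.trans hcy.le

/-- The upper Gibbs bound turns a lower bound for `∑ j, q j * log μ_j(B(x,r)) / log r` into an
upper bound for `ν(B(x,r))`. -/
theorem eventually_measure_closedBall_le_of_gibbs [∀ j, IsProbabilityMeasure (μ j)]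
    [IsProbabilityMeasure ν] (hrq : 0 < rq) (hK : 0 < Kup) (hφ : φ =o[𝓝[>] (0 : ℝ)] Real.log)
    {x : EuclideanSpace ℝ (Fin d)} (hx : x ∈ vsupport μ)
    (hG : ∀ r ∈ Ioo (0 : ℝ) rq, ν.real (Metric.closedBall x r) /
      ((∏ j, ((μ j).real (Metric.closedBall x r)) ^ (q j)) * (2 * r) ^ t * Real.exp (φ r)) ≤ Kup)
    {A s : ℝ} (hA : ∀ δ, 0 < δ → ∀ᶠ r in 𝓝[>] (0 : ℝ), A - δ ≤
      ∑ j, q j * (Real.log ((μ j).real (Metric.closedBall x r)) / Real.log r)) (hs : s < A + t) :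
    ∀ᶠ r in 𝓝[>] (0 : ℝ), ν (Metric.closedBall x r) ≤ ENNReal.ofReal (r ^ s) := by
  have hgap : 0 < (A + t - s) / 2 := by linarith
  filter_upwards [eventually_abs_add_abs_le_of_isLittleO_log hφ
    (Real.log Kup + t * Real.log 2) hgap, hA _ hgap, Ioo_mem_nhdsGT hrq,
    Ioo_mem_nhdsGT one_pos] with r h1 h2 hr hr1
  have hr0 := hr.1
  have hlog := Real.log_neg hr1.1 hr1.2
  have hM0 : 0 < ∏ j, ((μ j).real (Metric.closedBall x r)) ^ (q j) := Finset.prod_pos fun j _ =>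
      Real.rpow_pos_of_pos (measureReal_closedBall_pos hx hr0 j) _
  have hGx := hG r hr
  rw [div_le_iff₀ (by positivity), prod_rpow_eq_exp hx hr0,
    Real.rpow_def_of_pos (by positivity), ← Real.exp_log hK, ← Real.exp_add, ← Real.exp_add,
    ← Real.exp_add, Real.log_mul two_ne_zero hr0.ne'] at hGx
  rw [← ofReal_measureReal (measure_ne_top _ _), Real.rpow_def_of_pos hr0]
  refine ENNReal.ofReal_le_ofReal (hGx.trans (Real.exp_le_exp.2 ?_))
  simp_rw [← mul_div_assoc] at h2
  rw [← Finset.sum_div, le_div_iff_of_neg hlog] at h2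
  have h3 := le_abs_self (Real.log Kup + t * Real.log 2)
  have h4 := le_abs_self (φ r)
  linarith

theorem add_le_dimH_of_gibbs [∀ j, IsProbabilityMeasure (μ j)]
    [IsProbabilityMeasure ν] (hrq : 0 < rq) (hK : 0 < Kup) (hφ : φ =o[𝓝[>] (0 : ℝ)] Real.log)
    (hG : ∀ x ∈ vsupport μ, ∀ r ∈ Ioo (0 : ℝ) rq, ν.real (Metric.closedBall x r) /
      ((∏ j, ((μ j).real (Metric.closedBall x r)) ^ (q j)) * (2 * r) ^ t * Real.exp (φ r)) ≤ Kup)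
    {E : Set (EuclideanSpace ℝ (Fin d))} (hES : E ⊆ vsupport μ) (hE : ν E ≠ 0) {A : ℝ}
    (hA : ∀ x ∈ E, ∀ δ, 0 < δ → ∀ᶠ r in 𝓝[>] (0 : ℝ), A - δ ≤
      ∑ j, q j * (Real.log ((μ j).real (Metric.closedBall x r)) / Real.log r)) :
    ((A + t : ℝ) : EReal) ≤ ((dimH E : ℝ≥0∞) : EReal) := by
  refine le_of_forall_lt_imp_le_of_dense fun y hy => ?_
  obtain ⟨c, hyc, hc⟩ := EReal.lt_iff_exists_real_btwn.1 hy
  have hc := EReal.coe_lt_coe_iff.1 hc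
  refine hyc.le.trans ?_
  rcases le_or_gt c 0 with hc0 | hc0
  · exact (EReal.coe_le_coe_iff.2 hc0).trans (EReal.coe_ennreal_nonneg _)
  have h := le_dimH_of_eventually_measure_closedBall_le hE (s := c.toNNReal) fun x hx => by
    rw [Real.coe_toNNReal c hc0.le]
    exact eventually_measure_closedBall_le_of_gibbs hrq hK hφ (hES hx) (hG x (hES hx)) (hA x hx) hc
  refine le_trans (Eq.le ?_) (EReal.coe_ennreal_le_coe_ennreal_iff.2 h)
  rw [EReal.coe_nnreal_eq_coe_real, Real.coe_toNNReal c hc0.le]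

end Gibbs

/-! ### Local dimensions on the level sets -/

section LevelSets

variable {d k : ℕ} {μ : Fin k → Measure (EuclideanSpace ℝ (Fin d))}

theorem eventually_sub_lt_of_mem_lowerLevel {α : EuclideanSpace ℝ (Fin k)}
    {x : EuclideanSpace ℝ (Fin d)} (hx : x ∈ lowerLevel μ α) (j : Fin k) {δ : ℝ} (hδ : 0 < δ) :
    ∀ᶠ r in 𝓝[>] (0 : ℝ),
      α j - δ < Real.log ((μ j).real (Metric.closedBall x r)) / Real.log r := by
  have h : ((α j - δ : ℝ) : EReal) < lowerLocalDim (μ j) x :=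
    (EReal.coe_lt_coe_iff.2 (sub_lt_self _ hδ)).trans_le (hx.2 j)
  exact (eventually_lt_of_lt_liminf h).mono fun r hr => EReal.coe_lt_coe_iff.1 hr

theorem eventually_lt_add_of_mem_upperLevel {α : EuclideanSpace ℝ (Fin k)}
    {x : EuclideanSpace ℝ (Fin d)} (hx : x ∈ upperLevel μ α) (j : Fin k) {δ : ℝ} (hδ : 0 < δ) :
    ∀ᶠ r in 𝓝[>] (0 : ℝ),
      Real.log ((μ j).real (Metric.closedBall x r)) / Real.log r < α j + δ := by
  have h : upperLocalDim (μ j) x < ((α j + δ : ℝ) : EReal) :=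
    (hx.2 j).trans_lt (EReal.coe_lt_coe_iff.2 (lt_add_of_pos_right _ hδ))
  exact (eventually_lt_of_limsup_lt h).mono fun r hr => EReal.coe_lt_coe_iff.1 hr

theorem eventually_sum_sub_le {f : Fin k → ℝ → ℝ} {a : Fin k → ℝ} {l : Filter ℝ}
    (h : ∀ j δ, 0 < δ → ∀ᶠ r in l, a j - δ ≤ f j r) {δ : ℝ} (hδ : 0 < δ) :
    ∀ᶠ r in l, ∑ j, a j - δ ≤ ∑ j, f j r := by
  have hδ' : 0 < δ / (k + 1) := by positivity
  filter_upwards [eventually_all.2 fun j => h j _ hδ'] with r hr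
  have h1 := Finset.sum_le_sum fun j (_ : j ∈ Finset.univ) => hr j
  rw [Finset.sum_sub_distrib, Finset.sum_const, Finset.card_univ, Fintype.card_fin,
    nsmul_eq_mul] at h1
  have h2 : (k : ℝ) * (δ / (k + 1)) ≤ δ := by
    rw [← mul_div_assoc, div_le_iff₀ (by positivity)]
    nlinarith
  linarith

theorem inner_eq_sum (α q : EuclideanSpace ℝ (Fin k)) : inner ℝ α q = ∑ j, q j * α j := by
  simp [PiLp.inner_apply]

theorem eventually_inner_sub_le_of_nonneg {α q : EuclideanSpace ℝ (Fin k)} (hq : ∀ j, 0 ≤ q j)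
    {x : EuclideanSpace ℝ (Fin d)} (hx : x ∈ lowerLevel μ α) {δ : ℝ} (hδ : 0 < δ) :
    ∀ᶠ r in 𝓝[>] (0 : ℝ), inner ℝ α q - δ ≤
      ∑ j, q j * (Real.log ((μ j).real (Metric.closedBall x r)) / Real.log r) := by
  rw [inner_eq_sum]
  refine eventually_sum_sub_le (fun j η hη => ?_) hδ
  have hqj : 0 < |q j| + 1 := by positivity
  filter_upwards [eventually_sub_lt_of_mem_lowerLevel hx j (div_pos hη hqj)] with r hr
  have h1 := mul_le_mul_of_nonneg_left hr.le (hq j)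
  have h2 : |q j| * (η / (|q j| + 1)) ≤ η := by
    rw [← mul_div_assoc, div_le_iff₀ hqj]
    nlinarith
  rw [mul_sub] at h1
  rw [abs_of_nonneg (hq j)] at h1 h2
  linarith

theorem eventually_inner_sub_le_of_nonpos {α q : EuclideanSpace ℝ (Fin k)} (hq : ∀ j, q j ≤ 0)
    {x : EuclideanSpace ℝ (Fin d)} (hx : x ∈ upperLevel μ α) {δ : ℝ} (hδ : 0 < δ) :
    ∀ᶠ r in 𝓝[>] (0 : ℝ), inner ℝ α q - δ ≤
      ∑ j, q j * (Real.log ((μ j).real (Metric.closedBall x r)) / Real.log r) := by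
  rw [inner_eq_sum]
  refine eventually_sum_sub_le (fun j η hη => ?_) hδ
  have hqj : 0 < |q j| + 1 := by positivity
  filter_upwards [eventually_lt_add_of_mem_upperLevel hx j (div_pos hη hqj)] with r hr
  have h1 := mul_le_mul_of_nonpos_left hr.le (hq j)
  have h2 : |q j| * (η / (|q j| + 1)) ≤ η := by
    rw [← mul_div_assoc, div_le_iff₀ hqj]
    nlinarith
  rw [mul_add] at h1
  rw [abs_of_nonpos (hq j)] at h1 h2
  linarith

/-- On `X̲_α ∩ X̄^α` all the local dimensions exist as limits, so the sign of `p` is irrelevant. -/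
theorem tendsto_sum_of_mem_level_inter {α : EuclideanSpace ℝ (Fin k)}
    {x : EuclideanSpace ℝ (Fin d)} (hx : x ∈ lowerLevel μ α ∩ upperLevel μ α)
    (p : EuclideanSpace ℝ (Fin k)) :
    Tendsto (fun r => ∑ j, p j * (Real.log ((μ j).real (Metric.closedBall x r)) / Real.log r))
      (𝓝[>] 0) (𝓝 (inner ℝ α p)) := by
  rw [inner_eq_sum]
  refine tendsto_finsetSum _ fun j _ => Tendsto.const_mul _ ?_
  exact EReal.tendsto_coe.1 (tendsto_of_le_liminf_of_limsup_le (hx.1.2 j) (hx.2.2 j))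

/-- Subtracting the finite number `⟨α, p⟩` reduces the bound to each `t` in the set defining
`b_μ(p)`, whether or not `b_μ(p)` is finite. -/
theorem mixedSpectrum_le_legendre_bDim [∀ j, IsProbabilityMeasure (μ j)]
    {α : EuclideanSpace ℝ (Fin k)} (hne : (lowerLevel μ α ∩ upperLevel μ α).Nonempty) :
    mixedSpectrum μ α ≤ legendre (bDim μ) α := by
  refine le_iInf fun p => ?_
  rw [add_comm, ← EReal.sub_le_iff_le_add (.inl (EReal.coe_ne_bot _)) (.inl (EReal.coe_ne_top _))]
  refine le_sInf ?_
  rintro _ ⟨t, ht, rfl⟩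
  refine EReal.sub_le_of_le_add' ?_
  rw [← EReal.coe_add]
  refine dimH_le_of_mixedHausdorff_eq_zero (fun x hx => hx.1.1) hne ht fun x hx δ hδ => ?_
  exact ((tendsto_sum_of_mem_level_inter hx p).eventually_lt_const
    (lt_add_of_pos_right _ hδ)).mono fun _ => le_of_lt

theorem legendre_mono {f g : EuclideanSpace ℝ (Fin k) → EReal} (h : ∀ q, f q ≤ g q)
    (α : EuclideanSpace ℝ (Fin k)) : legendre f α ≤ legendre g α :=
  iInf_mono fun q => add_le_add_right (h q) _

end LevelSets

/-! ### One-sided gradients at a point of differentiability -/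

section Gradient

variable {k : ℕ} {C : EuclideanSpace ℝ (Fin k) → ℝ}

theorem hasDerivAt_axisRestrict (hC : DifferentiableAt ℝ C 0) (j : Fin k) :
    HasDerivAt (axisRestrict C j) (gradient C 0 j) 0 := by
  have hline : ∀ s : ℝ, (EuclideanSpace.single j s : EuclideanSpace ℝ (Fin k)) =
      s • EuclideanSpace.single j 1 := by
    intro s
    ext i
    by_cases hi : i = j <;> simp [hi]
  have h1 : HasDerivAt (fun s : ℝ => s • (EuclideanSpace.single j 1 : EuclideanSpace ℝ (Fin k)))
      (EuclideanSpace.single j 1) 0 := by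
    simpa using (hasDerivAt_id (0 : ℝ)).smul_const
      (EuclideanSpace.single j 1 : EuclideanSpace ℝ (Fin k))
  have h2 := hC.hasGradientAt.hasFDerivAt
  rw [← zero_smul ℝ (EuclideanSpace.single j 1 : EuclideanSpace ℝ (Fin k))] at h2
  have h3 := h2.comp_hasDerivAt (0 : ℝ) h1
  have h4 : axisRestrict C j = C ∘ fun s : ℝ => s • EuclideanSpace.single j 1 := by
    funext s
    simp [axisRestrict, ← hline]
  rw [h4]
  refine h3.congr_deriv ?_
  rw [zero_smul, InnerProductSpace.toDual_apply_apply, EuclideanSpace.inner_single_right]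
  simp

theorem rightGrad_eq_gradient (hC : DifferentiableAt ℝ C 0) : rightGrad C = gradient C 0 := by
  ext j
  exact (hasDerivAt_axisRestrict hC j).hasDerivWithinAt.derivWithin (uniqueDiffWithinAt_Ioi 0)

theorem leftGrad_eq_gradient (hC : DifferentiableAt ℝ C 0) : leftGrad C = gradient C 0 := by
  ext j
  exact (hasDerivAt_axisRestrict hC j).hasDerivWithinAt.derivWithin (uniqueDiffWithinAt_Iio 0)

end Gradient

end MixedMultifractal

open MixedMultifractal in
theorem mainTheorem1 {d k : ℕ}
    (μ : Fin k → Measure (EuclideanSpace ℝ (Fin d))) [∀ j, IsProbabilityMeasure (μ j)]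
    (q : EuclideanSpace ℝ (Fin k)) (t rq Klow Kup : ℝ)
    (hrq : 0 < rq) (hKlow : 0 < Klow) (hKup : 0 < Kup)
    (ν : Measure (EuclideanSpace ℝ (Fin d))) [IsProbabilityMeasure ν]
    (hν : ν (vsupport μ)ᶜ = 0)
    (φ : ℝ → ℝ) (hφ : φ =o[𝓝[>] (0 : ℝ)] Real.log)
    (ρ : ℕ → ℝ) (hρ_mem : ∀ n, ρ n ∈ Set.Ioo (0 : ℝ) 1) (hρ_anti : Antitone ρ)
    (hρ_lim : Tendsto ρ atTop (𝓝 0))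
    (hρ_log : Tendsto (fun n => Real.log (ρ (n + 1)) / Real.log (ρ n)) atTop (𝓝 1))
    (hρ_sum : ∀ ε : ℝ, 0 < ε → Summable (fun n => (ρ n) ^ ε))
    (hA1 : ∀ x ∈ vsupport μ, ∀ r ∈ Set.Ioo (0 : ℝ) rq,
      Klow ≤ ν.real (Metric.closedBall x r) /
          ((∏ j, ((μ j).real (Metric.closedBall x r)) ^ (q j)) * (2 * r) ^ t * Real.exp (φ r)) ∧
        ν.real (Metric.closedBall x r) /
          ((∏ j, ((μ j).real (Metric.closedBall x r)) ^ (q j)) * (2 * r) ^ t * Real.exp (φ r))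
          ≤ Kup)
    (C : EuclideanSpace ℝ (Fin k) → ℝ)
    (hA2 : ∀ p : EuclideanSpace ℝ (Fin k),
      Tendsto (fun n => momentExponent μ ν (ρ n) p) atTop (𝓝 ((C p : ℝ) : EReal))) :
    -- the one-sided partial derivatives of `C` at `0` exist
    (∀ j, DifferentiableWithinAt ℝ (axisRestrict C j) (Set.Ioi 0) 0 ∧
      DifferentiableWithinAt ℝ (axisRestrict C j) (Set.Iio 0) 0) ∧
    ((∀ j, q j ≤ 0) →
      ((inner ℝ (-leftGrad C) q : ℝ) : EReal) + LambdaDim μ q ≤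
          ((dimH (lowerLevel μ (-rightGrad C) ∩ upperLevel μ (-leftGrad C)) : ℝ≥0∞) : EReal) ∧
        ((inner ℝ (-leftGrad C) q : ℝ) : EReal) + BDim μ q ≤
          ((inner ℝ (-leftGrad C) q : ℝ) : EReal) + LambdaDim μ q ∧
        ((inner ℝ (-leftGrad C) q : ℝ) : EReal) + bDim μ q ≤
          ((inner ℝ (-leftGrad C) q : ℝ) : EReal) + BDim μ q) ∧
    ((∀ j, 0 ≤ q j) →
      ((inner ℝ (-rightGrad C) q : ℝ) : EReal) + LambdaDim μ q ≤
          ((dimH (lowerLevel μ (-rightGrad C) ∩ upperLevel μ (-leftGrad C)) : ℝ≥0∞) : EReal) ∧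
        ((inner ℝ (-rightGrad C) q : ℝ) : EReal) + BDim μ q ≤
          ((inner ℝ (-rightGrad C) q : ℝ) : EReal) + LambdaDim μ q ∧
        ((inner ℝ (-rightGrad C) q : ℝ) : EReal) + bDim μ q ≤
          ((inner ℝ (-rightGrad C) q : ℝ) : EReal) + BDim μ q) ∧
    (DifferentiableAt ℝ C 0 →
      mixedSpectrum μ (-gradient C 0) = legendre (bDim μ) (-gradient C 0) ∧
        mixedSpectrum μ (-gradient C 0) = legendre (BDim μ) (-gradient C 0) ∧
        mixedSpectrum μ (-gradient C 0) = legendre (LambdaDim μ) (-gradient C 0)) := by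
  have hconv : ConvexOn ℝ univ C := convexOn_of_tendsto_momentExponent hρ_mem hA2
  have hdiff : ∀ j, DifferentiableWithinAt ℝ (axisRestrict C j) (Set.Ioi 0) 0 ∧
      DifferentiableWithinAt ℝ (axisRestrict C j) (Set.Iio 0) 0 := fun j =>
    ⟨(convexOn_axisRestrict hconv j).differentiableWithinAt_Ioi_of_mem_interior (by simp),
      (convexOn_axisRestrict hconv j).differentiableWithinAt_Iio_of_mem_interior (by simp)⟩
  have hae := ae_mem_level_inter hν hρ_mem hρ_lim hρ_log hρ_sum hA2 hdiff
  set E := lowerLevel μ (-rightGrad C) ∩ upperLevel μ (-leftGrad C) with hE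
  have hES : E ⊆ vsupport μ := fun x hx => hx.1.1
  have hE0 : ν E ≠ 0 := fun h0 => by
    have hfalse : ∀ᵐ _ ∂ν, False :=
      (hae.and (measure_eq_zero_iff_ae_notMem.1 h0)).mono fun x hx => hx.2 hx.1
    exact IsProbabilityMeasure.ne_zero ν (by simpa using hfalse)
  have hΛ : LambdaDim μ q ≤ (t : EReal) :=
    LambdaDim_le_of_gibbs hrq hKlow hφ fun x hx r hr => (hA1 x hx r hr).1
  have hmass : ∀ A : ℝ, (∀ x ∈ E, ∀ δ, 0 < δ → ∀ᶠ r in 𝓝[>] (0 : ℝ), A - δ ≤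
      ∑ j, q j * (Real.log ((μ j).real (Metric.closedBall x r)) / Real.log r)) →
      (A : EReal) + LambdaDim μ q ≤ ((dimH E : ℝ≥0∞) : EReal) := fun A hA => by
    refine (add_le_add_right hΛ _).trans ?_
    rw [← EReal.coe_add]
    exact add_le_dimH_of_gibbs hrq hKup hφ (fun x hx r hr => (hA1 x hx r hr).2) hES hE0 hA
  refine ⟨hdiff, fun hq => ⟨?_, add_le_add_right (BDim_le_LambdaDim μ q) _,
    add_le_add_right (bDim_le_BDim μ q) _⟩, fun hq => ⟨?_,
    add_le_add_right (BDim_le_LambdaDim μ q) _, add_le_add_right (bDim_le_BDim μ q) _⟩,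
    fun hC => ?_⟩
  · exact hmass _ fun x hx δ hδ => eventually_inner_sub_le_of_nonpos hq hx.2 hδ
  · exact hmass _ fun x hx δ hδ => eventually_inner_sub_le_of_nonneg hq hx.1 hδ
  rw [rightGrad_eq_gradient hC, leftGrad_eq_gradient hC] at hE
  have hlow : legendre (LambdaDim μ) (-gradient C 0) ≤ mixedSpectrum μ (-gradient C 0) := by
    refine (iInf_le _ q).trans ?_
    rw [mixedSpectrum, ← hE]
    refine hmass _ fun x hx δ hδ => ?_
    rw [hE] at hx
    exact ((tendsto_sum_of_mem_level_inter hx q).eventually_const_lt (sub_lt_self _ hδ)).mono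
      fun _ => le_of_lt
  have hup : mixedSpectrum μ (-gradient C 0) ≤ legendre (bDim μ) (-gradient C 0) :=
    mixedSpectrum_le_legendre_bDim (hE ▸ nonempty_of_measure_ne_zero hE0)
  have hbB := legendre_mono (bDim_le_BDim μ) (-gradient C 0)
  have hBΛ := legendre_mono (BDim_le_LambdaDim μ) (-gradient C 0)
  exact ⟨le_antisymm hup ((hbB.trans hBΛ).trans hlow),
    le_antisymm (hup.trans hbB) (hBΛ.trans hlow),
    le_antisymm (hup.trans (hbB.trans hBΛ)) hlow⟩
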